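/- Let $\mathcal F$ be a fusion ring of multiplicity one: it has a finite basis $(X_i)_{i\in I}$ with $X_iX_j=\sum_k n_{i,j}^kX_k$, $n_{i,j}^k\in\{0,1\}$, unit $X_0$ and involution $i\mapsto i^*$. Let $\mathrm{FPdim}(X_i)$ be the spectral radius of the matrix of left multiplication by $X_i$, and $\mathrm{FPdim}(\mathcal F)=\sum_i\mathrm{FPdim}(X_i)^2$. Let $$F=\left(\begin{pmatrix} i_1&i_2&i_3\\ i_4&i_5&i_6\end{pmatrix}_F\right)_{i_1,\dots,i_6\in I}$$ be complex numbers, vanishing (by convention) unless $n_{i_1,i_2}^{i_3}n_{i_3,i_4}^{i_5}n_{i_2,i_4}^{i_6}n_{i_1,i_6}^{i_5}\neq 0$, which satisfy the pentagon equation: for all $i_1,\dots,i_9\in I$, $$\begin{pmatrix} i_2&i_7&i_8\\ i_9&i_3&i_1\end{pmatrix}_F\begin{pmatrix} i_5&i_4&i_2\\ i_1&i_3&i_6\end{pmatrix}_F=\sum_{i_0}\begin{pmatrix} i_5&i_4&i_2\\ i_7&i_8&i_0\end{pmatrix}_F\begin{pmatrix} i_5&i_0&i_8\\ i_9&i_3&i_6\end{pmatrix}_F\begin{pmatrix}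 i_4&i_7&i_0\\ i_9&i_6&i_1\end{pmatrix}_F .$$ Let $d(X_i)$ $(i\in I)$ be real numbers, put $\begin{pmatrix} i_1&i_2&i_3\\ i_4&i_5&i_6\end{pmatrix}:=d(X_{i_6})^{-1}\begin{pmatrix} i_1&i_2&i_3\\ i_4&i_5&i_6\end{pmatrix}_F$, and let $(p_i)_{i\in I}$ be pivotal indicators of $F$, i.e. complex numbers with $p_0=1$, $p_ip_{i^*}=1$ and, whenever $n_{i,j}^k\ne0$, $$p_i^{-1}p_j^{-1}p_k=\begin{pmatrix} i&j&k\\ k^*&0&i^*\end{pmatrix}_F\begin{pmatrix} j&k^*&i^*\\ i&0&j^*\end{pmatrix}_F\begin{pmatrix} k^*&i&j^*\\ j&0&k\end{pmatrix}_F .$$ Assume: (a) $d(X_i)=\mathrm{FPdim}(X_i)$ for all $i$; (b) $p_i=1$ for all $i$; (c) $\begin{pmatrix} i_1&i_2&i_3\\ 0&i_3&i_2\end{pmatrix}=d(X_{i_2})^{-1/2}d(X_{i_3})^{-1/2}$ whenever $n_{i_1,i_2}^{i_3}\neq0$; (d) ($A_4$-symmetry) for all $i_1,\dots,i_6$, $\begin{pmatrix}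 i_1&i_2&i_3\\ i_4&i_5&i_6\end{pmatrix}=\begin{pmatrix} i_2&i_3^*&i_1^*\\ i_5&i_6&i_4\end{pmatrix}=\begin{pmatrix} i_2^*&i_6&i_4\\ i_5^*&i_3^*&i_1^*\end{pmatrix}$. Then there is a complex fusion category $\mathcal C$ with a spherical pivotal structure which is a pseudo-unitary categorification of $\mathcal F$ with F-symbols $F$. That is: its simple objects up to isomorphism are represented, without repetition, by objects $X_i$ $(i\in I)$, with $X_0\cong\mathbf 1$, $X_i^*\cong X_{i^*}$ and $\dim\mathrm{Hom}(X_i\otimes X_j,X_k)=n_{i,j}^k$; there are morphisms $v_{ij}^k:X_i\otimes X_j\to X_k$, nonzero whenever $n_{i,j}^k\ne0$, such that for all $i_1,\dots,i_5$ $$v_{i_3i_4}^{i_5}\circ(v_{i_1i_2}^{i_3}\otimes\mathrm{id}_{X_{i_4}})=\sum_{i_6}\begin{pmatrix} i_1&i_2&i_3\\ i_4&i_5&i_6\end{pmatrix}_F v_{i_1i_6}^{i_5}\circ(\mathrm{id}_{X_{i_1}}\otimes v_{i_2i_4}^{i_6})\circ\alpha_{X_{i_1},X_{i_2},X_{i_4}},$$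 where $\alpha$ is the associator; the dimension of $X_i$ in the spherical structure is $d(X_i)$; and the global dimension of $\mathcal C$ equals $\mathrm{FPdim}(\mathcal F)$. If furthermore, for all $i_1,\dots,i_6$, $$\overline{\begin{pmatrix} i_1&i_2&i_3\\ i_4&i_5&i_6\end{pmatrix}}=\begin{pmatrix} i_1^*&i_3&i_2\\ i_4&i_6&i_5\end{pmatrix},$$ then the category $\mathcal C$ is unitary, i.e. it has a C*-structure for which $(f\otimes g)^\dagger=f^\dagger\otimes g^\dagger$ and the associators and unitors are unitary. -/

import Mathlib

open CategoryTheory CategoryTheory.Limits CategoryTheory.MonoidalCategory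

universe u v

/-! ### Fusion rings -/

/-- A fusion ring (a unital based ring of finite rank) with basis indexed by the finite set `I`,
given by its structure constants: `X i * X j = ∑ k, N i j k • X k`, with unit `X one` and with the
involution `X i ↦ X (dual i)`. -/
structure FusionRing (I : Type u) [Fintype I] [DecidableEq I] where
  /-- the structure constants -/
  N : I → I → I → ℕ
  /-- the index of the unit -/
  one : I
  /-- the involution `i ↦ i*` on the basis -/
  dual : I → I
  one_mul : ∀ j k, N one j k = if j = k then 1 else 0
  mul_one : ∀ i k, N i one k = if i = k then 1 else 0
  assoc : ∀ i j k l, ∑ m, N i j m * N m k l = ∑ m, N j k m * N i m l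
  dual_dual : ∀ i, dual (dual i) = i
  dual_mul : ∀ i j k, N (dual j) (dual i) (dual k) = N i j k
  mul_coeff_one : ∀ i j, N i j one = if j = dual i then 1 else 0

namespace FusionRing

variable {I : Type u} [Fintype I] [DecidableEq I] (R : FusionRing I)

/-- A fusion ring is of multiplicity one if all its structure constants are at most `1`. -/
def MultiplicityOne : Prop := ∀ i j k, R.N i j k ≤ 1

/-- The matrix of the left multiplication by `X i` in the basis `X`. -/
def leftMulMatrix (i : I) : Matrix I I ℂ := Matrix.of fun k j => (R.N i j k : ℂ)

/-- The Frobenius-Perron dimension of `X i`: the spectral radius of the (entrywise nonnegative)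
matrix of the left multiplication by `X i`, i.e. its Frobenius-Perron eigenvalue. -/
noncomputable def FPdim (i : I) : ℝ := (spectralRadius ℂ (R.leftMulMatrix i)).toReal

/-- The Frobenius-Perron dimension of the fusion ring. -/
noncomputable def totalFPdim : ℝ := ∑ i, R.FPdim i ^ 2

/-! ### Solutions of the pentagon equation

A function `F` of six labels is written `F i₁ i₂ i₃ i₄ i₅ i₆` for the symbol with first row
`i₁ i₂ i₃` and second row `i₄ i₅ i₆`.  -/

/-- The labels of a nontrivial F-symbol: all four trivalent vertices
`i₁ ⊗ i₂ → i₃`, `i₃ ⊗ i₄ → i₅`, `i₂ ⊗ i₄ → i₆`, `i₁ ⊗ i₆ → i₅` exist. -/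
def Admissible (i₁ i₂ i₃ i₄ i₅ i₆ : I) : Prop :=
  R.N i₁ i₂ i₃ ≠ 0 ∧ R.N i₃ i₄ i₅ ≠ 0 ∧ R.N i₂ i₄ i₆ ≠ 0 ∧ R.N i₁ i₆ i₅ ≠ 0

/-- `F` is a solution of the (multiplicity one) pentagon equation of `R`; the F-symbols which do
not make sense are `0` by convention. -/
structure IsPentagonSolution (F : I → I → I → I → I → I → ℂ) : Prop where
  eq_zero : ∀ i₁ i₂ i₃ i₄ i₅ i₆, ¬ R.Admissible i₁ i₂ i₃ i₄ i₅ i₆ → F i₁ i₂ i₃ i₄ i₅ i₆ = 0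
  pentagon : ∀ i₁ i₂ i₃ i₄ i₅ i₆ i₇ i₈ i₉,
    F i₂ i₇ i₈ i₉ i₃ i₁ * F i₅ i₄ i₂ i₁ i₃ i₆ =
      ∑ i₀, F i₅ i₄ i₂ i₇ i₈ i₀ * F i₅ i₀ i₈ i₉ i₃ i₆ * F i₄ i₇ i₀ i₉ i₆ i₁

/-- `p` is a family of pivotal indicators (pivotal coefficients) of `F`: the scalars `p i`
define, with respect to the duality pairings given by the vertices `i* ⊗ i → 1`, a pivotal
structure on the associated fusion category.  -/
structure IsPivotalIndicator (F : I → I → I → I → I → I → ℂ) (p : I → ℂ) : Prop where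
  one : p R.one = 1
  dual : ∀ i, p i * p (R.dual i) = 1
  rotation : ∀ i j k, R.N i j k ≠ 0 →
    (p i)⁻¹ * (p j)⁻¹ * p k =
      F i j k (R.dual k) R.one (R.dual i) *
      F j (R.dual k) (R.dual i) i R.one (R.dual j) *
      F (R.dual k) i (R.dual j) j R.one k

/-- The tetrahedral symbols: the F-symbols divided by `d i₆`. -/
noncomputable def tetra (d : I → ℝ) (F : I → I → I → I → I → I → ℂ)
    (i₁ i₂ i₃ i₄ i₅ i₆ : I) : ℂ :=
  ((d i₆ : ℂ))⁻¹ * F i₁ i₂ i₃ i₄ i₅ i₆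

/-- Evaluation of the tetrahedral symbols when one object is trivial. -/
def IsNormalized (d : I → ℝ) (T : I → I → I → I → I → I → ℂ) : Prop :=
  ∀ i₁ i₂ i₃, R.N i₁ i₂ i₃ ≠ 0 →
    T i₁ i₂ i₃ R.one i₃ i₂ = ((d i₂ ^ (-(1 / 2) : ℝ) * d i₃ ^ (-(1 / 2) : ℝ) : ℝ) : ℂ)

/-- Invariance of the tetrahedral symbols under the group `A₄` of the rotations of the
tetrahedron, given by a rotation of order `3` and one of order `2`. -/
def IsA4Symmetric (T : I → I → I → I → I → I → ℂ) : Prop :=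
  ∀ i₁ i₂ i₃ i₄ i₅ i₆,
    T i₁ i₂ i₃ i₄ i₅ i₆ = T i₂ (R.dual i₃) (R.dual i₁) i₅ i₆ i₄ ∧
    T i₁ i₂ i₃ i₄ i₅ i₆ = T (R.dual i₂) i₆ i₄ (R.dual i₅) (R.dual i₃) (R.dual i₁)

/-- The reflection of the tetrahedron is the complex conjugation. -/
def IsReflectionSymmetric (T : I → I → I → I → I → I → ℂ) : Prop :=
  ∀ i₁ i₂ i₃ i₄ i₅ i₆,
    (starRingEnd ℂ) (T i₁ i₂ i₃ i₄ i₅ i₆) = T (R.dual i₁) i₃ i₂ i₄ i₆ i₅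

end FusionRing

/-! ### Complex fusion categories -/

section

attribute [local instance] Abelian.hasFiniteBiproducts

/-- A complex fusion category: a `ℂ`-linear abelian rigid monoidal category with bilinear tensor
product, finite dimensional spaces of morphisms, in which every object is a finite direct sum of
simple objects, with finitely many simple objects up to isomorphism and with a simple unit. -/
class FusionCategory (C : Type u) [Category.{v} C] [Abelian C] [Linear ℂ C]
    [MonoidalCategory C] [RigidCategory C] : Prop
    extends MonoidalPreadditive C, MonoidalLinear ℂ C where
  finiteDimensional_hom : ∀ X Y : C, FiniteDimensional ℂ (X ⟶ Y)
  semisimple : ∀ X : C, ∃ (n : ℕ) (S : Fin n → C),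
    (∀ i, Simple (S i)) ∧ Nonempty (X ≅ ⨁ S)
  finite_simples : ∃ (n : ℕ) (S : Fin n → C),
    ∀ Y : C, Simple Y → ∃ i, Nonempty (Y ≅ S i)
  simple_unit : Simple (𝟙_ C)

end

/-- A pivotal structure on a rigid monoidal category: a monoidal natural isomorphism from the
identity functor to the double dual functor. (The compatibility with the units follows, because
the components are invertible.) -/
structure PivotalStructure (C : Type u) [Category.{v} C] [MonoidalCategory C]
    [RigidCategory C] where
  /-- the components `X ≅ X**` -/
  iso : ∀ X : C, X ≅ (Xᘁ)ᘁ
  naturality : ∀ {X Y : C} (f : X ⟶ Y), f ≫ (iso Y).hom = (iso X).hom ≫ (fᘁ)ᘁ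
  /-- The monoidal structure `X** ⊗ Y** ≅ (Y* ⊗ X*)* ≅ (X ⊗ Y)**` of the double dual functor
  comes from the canonical isomorphisms `(X ⊗ Y)* ≅ Y* ⊗ X*`. -/
  tensor : ∀ X Y : C,
    (iso (X ⊗ Y)).hom =
      ((iso X).hom ⊗ₘ (iso Y).hom) ≫ (rightDualTensorIso (Yᘁ) (Xᘁ)).inv ≫
        ((rightDualTensorIso X Y).hom)ᘁ

namespace PivotalStructure

variable {C : Type u} [Category.{v} C] [MonoidalCategory C] [RigidCategory C]
  (P : PivotalStructure C)

/-- The trace `1 → X ⊗ X* → X** ⊗ X* → 1` of an endomorphism. -/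
def traceRight {X : C} (f : X ⟶ X) : 𝟙_ C ⟶ 𝟙_ C :=
  η_ X (Xᘁ) ≫ ((f ≫ (P.iso X).hom) ▷ Xᘁ) ≫ ε_ (Xᘁ) ((Xᘁ)ᘁ)

/-- The trace `1 → X* ⊗ X** → X* ⊗ X → 1` of an endomorphism. -/
def traceLeft {X : C} (f : X ⟶ X) : 𝟙_ C ⟶ 𝟙_ C :=
  η_ (Xᘁ) ((Xᘁ)ᘁ) ≫ (Xᘁ ◁ ((P.iso X).inv ≫ f)) ≫ ε_ X (Xᘁ)

/-- The dimension of an object, as an endomorphism of the unit object. -/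
def dim (X : C) : 𝟙_ C ⟶ 𝟙_ C := P.traceRight (𝟙 X)

/-- A pivotal structure is spherical if the left and right traces agree. -/
def IsSpherical : Prop := ∀ (X : C) (f : X ⟶ X), P.traceLeft f = P.traceRight f

end PivotalStructure

/-- A unitary structure on a `ℂ`-linear monoidal category: a dagger `†` making it a C*-category
and for which the tensor product of morphisms is a `*`-operation and the associators and the
unitors are unitary. (When the spaces of morphisms are finite dimensional, `definite` and
`positive` say that the `*`-category is a C*-category.) -/
structure UnitaryStructure (C : Type u) [Category.{v} C] [Preadditive C] [Linear ℂ C]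
    [MonoidalCategory C] where
  /-- the adjoint of a morphism -/
  dag : ∀ {X Y : C}, (X ⟶ Y) → (Y ⟶ X)
  dag_dag : ∀ {X Y : C} (f : X ⟶ Y), dag (dag f) = f
  dag_comp : ∀ {X Y Z : C} (f : X ⟶ Y) (g : Y ⟶ Z), dag (f ≫ g) = dag g ≫ dag f
  dag_add : ∀ {X Y : C} (f g : X ⟶ Y), dag (f + g) = dag f + dag g
  dag_smul : ∀ {X Y : C} (c : ℂ) (f : X ⟶ Y), dag (c • f) = (starRingEnd ℂ) c • dag f
  definite : ∀ {X Y : C} (f : X ⟶ Y), f ≫ dag f = 0 → f = 0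
  positive : ∀ {X Y : C} (f : X ⟶ Y), ∃ g : X ⟶ X, f ≫ dag f = g ≫ dag g
  dag_tensor : ∀ {X Y X' Y' : C} (f : X ⟶ Y) (g : X' ⟶ Y'),
    dag (f ⊗ₘ g) = dag f ⊗ₘ dag g
  dag_associator : ∀ X Y Z : C, dag (α_ X Y Z).hom = (α_ X Y Z).inv
  dag_leftUnitor : ∀ X : C, dag (λ_ X).hom = (λ_ X).inv
  dag_rightUnitor : ∀ X : C, dag (ρ_ X).hom = (ρ_ X).inv

/-- A fusion category is unitary if it admits a unitary structure. -/
def IsUnitaryCategory (C : Type u) [Category.{v} C] [Preadditive C] [Linear ℂ C]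
    [MonoidalCategory C] : Prop :=
  Nonempty (UnitaryStructure C)

/-! ### Categorifications -/

namespace FusionRing

variable {I : Type u} [Fintype I] [DecidableEq I] (R : FusionRing I)
  {C : Type u} [Category.{v} C] [Abelian C] [Linear ℂ C] [MonoidalCategory C] [RigidCategory C]

/-- The fusion category `C` is a categorification of `R` through the objects `X i`: they
represent each isomorphism class of simple objects exactly once, and `X i ↦ [X i]` identifies `R`
with the Grothendieck ring of `C` (with its unit and its involution). -/
structure IsCategorification (X : I → C) : Prop where
  simple : ∀ i, Simple (X i)
  injective : ∀ i j, Nonempty (X i ≅ X j) → i = j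
  surjective : ∀ Y : C, Simple Y → ∃ i, Nonempty (Y ≅ X i)
  unit : Nonempty (X R.one ≅ 𝟙_ C)
  dual : ∀ i, Nonempty ((X i)ᘁ ≅ X (R.dual i))
  multiplicity : ∀ i j k, Module.finrank ℂ (X i ⊗ X j ⟶ X k) = R.N i j k

/-- The associativity constraint of `C` is given by the F-symbols `F`, in suitable bases (i.e.
nonzero vectors) `v i j k` of the spaces `Hom(X i ⊗ X j, X k)` of dimension one. -/
def RealizesFSymbols (X : I → C) (F : I → I → I → I → I → I → ℂ) : Prop :=
  ∃ v : ∀ i j k, X i ⊗ X j ⟶ X k,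
    (∀ i j k, R.N i j k ≠ 0 → v i j k ≠ 0) ∧
    ∀ i₁ i₂ i₃ i₄ i₅,
      (v i₁ i₂ i₃ ▷ X i₄) ≫ v i₃ i₄ i₅ =
        ∑ i₆, F i₁ i₂ i₃ i₄ i₅ i₆ •
          ((α_ (X i₁) (X i₂) (X i₄)).hom ≫ (X i₁ ◁ v i₂ i₄ i₆) ≫ v i₁ i₆ i₅)

/-- A categorification of `R` with a pivotal structure is pseudo-unitary if its global dimension
`∑ i, |X i|²`, where `|X i|² = dim (X i) * dim (X i)*`, is its Frobenius-Perron dimension. -/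
def IsPseudoUnitary (X : I → C) (P : PivotalStructure C) : Prop :=
  ∑ i, P.dim (X i) ≫ P.dim ((X i)ᘁ) = ((R.totalFPdim : ℝ) : ℂ) • 𝟙 (𝟙_ C)

end FusionRing

/-!
The category is built by hand from the symbols, as a category of matrices.

*The symbols.* Put `T = tetra d F` and pass to the unitary gauge `U = √(d i₃ d i₆) T`. In the
pentagon equation, one label is made trivial: three of the five tetrahedra degenerate and, by the
normalization, the equation becomes an orthogonality relation. Hence the recoupling matrices `U` are
invertible, and their inverses `V` are given by the symbols of the mirror image
(`gaugeU_mul_gaugeV`). The `A₄`-symmetry moves a trivial label to the position at which the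
normalization applies, so that all symbols with a trivial label are explicit: they are `1`, or
quotients of square roots of dimensions. This is collected in `SphericalSymbols`. The dimensions are
positive because left multiplication by a basis element of a fusion ring is not nilpotent.

*The category.* An object is a finite family of labels, the formal direct sum of the corresponding
simple objects, and a morphism is a matrix which vanishes between different labels. The tensor
product of two families has one summand for each pair of summands and each label of the fusion
product; the associator has the matrix `V` and its inverse the matrix `U`, so that the pentagon axiom
is the pentagon equation (`assocInv_pentagon`). The functor of multiplicity spaces is an equivalence
with families of finite dimensional vector spaces, which makes the category abelian. The vertices
`X i ⊗ X j ⟶ X k`, rescaled by `1 / √(d k)`, realize the F-symbols (`realizesFSymbols`).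

*Duality.* The dual of a family has the dual labels, and the evaluation and coevaluation are `√(d i)`
on the summand `i`. The evaluations of the symbols at trivial labels show that the mate of a morphism
is its transpose and that the canonical isomorphism `(X ⊗ Y)* ≅ Y* ⊗ X*` is a permutation matrix.
Therefore the identity matrices `X ⟶ X**` form a pivotal structure (`pivotal`). Its two traces are
both the trace weighted by `d` (`pivotal_isSpherical`); in particular the dimension of `X i` is `d i`,
and the global dimension is the Frobenius-Perron dimension.

*Unitarity.* If the reflection acts by complex conjugation, the inverse `V` of `U` is its conjugate,
the associators are unitary matrices, and the conjugate transpose is a unitary structure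
(`unitaryStructure`).
-/

/-! ### Fusion rings: Frobenius reciprocity and dimensions -/

namespace FusionRing

variable {I : Type u} [Fintype I] [DecidableEq I] (R : FusionRing I)

theorem dual_one : R.dual R.one = R.one := by
  have h := R.mul_coeff_one R.one R.one
  rw [R.one_mul] at h
  by_contra hne
  simp [Ne.symm hne] at h

theorem dual_injective : Function.Injective R.dual :=
  Function.LeftInverse.injective R.dual_dual

theorem dual_eq_iff {i j : I} : R.dual i = R.dual j ↔ i = j := R.dual_injective.eq_iff

/-- The involution as a permutation of the basis. -/
def dualEquiv : I ≃ I := ⟨R.dual, R.dual, R.dual_dual, R.dual_dual⟩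

theorem N_one_left_ne {j k : I} : R.N R.one j k ≠ 0 ↔ j = k := by
  rw [R.one_mul]; split_ifs <;> simp_all

theorem N_one_right_ne {i k : I} : R.N i R.one k ≠ 0 ↔ i = k := by
  rw [R.mul_one]; split_ifs <;> simp_all

theorem N_one_out_ne {i j : I} : R.N i j R.one ≠ 0 ↔ j = R.dual i := by
  rw [R.mul_coeff_one]; split_ifs <;> simp_all

/-- Frobenius reciprocity: compare the coefficients of the unit in `(X i * X j) * X k*` and
`X i * (X j * X k*)`. -/
theorem N_rotate (i j k : I) : R.N i j k = R.N j (R.dual k) (R.dual i) := by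
  have h := R.assoc i j (R.dual k) R.one
  simp only [R.mul_coeff_one] at h
  have e1 : ∀ m, (R.dual k = R.dual m) ↔ (m = k) := fun m => by
    rw [R.dual_eq_iff]; exact eq_comm
  simpa [e1] using h

theorem N_flip (i j k : I) : R.N i j k = R.N k (R.dual j) i := by
  rw [R.N_rotate, ← R.dual_mul, R.dual_dual, R.dual_dual]

/-- Left multiplication by `X i*` is adjoint to left multiplication by `X i`. -/
theorem leftMulMatrix_dual (i : I) :
    R.leftMulMatrix (R.dual i) = (R.leftMulMatrix i).transpose := by
  ext k j
  simp only [leftMulMatrix, Matrix.of_apply, Matrix.transpose_apply]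
  rw [R.N_rotate, R.dual_dual, R.N_flip i k j]

theorem FPdim_dual (i : I) : R.FPdim (R.dual i) = R.FPdim i := by
  unfold FPdim
  congr 1
  have : spectrum ℂ (R.leftMulMatrix (R.dual i)) = spectrum ℂ (R.leftMulMatrix i) := by
    ext z
    rw [leftMulMatrix_dual, spectrum.mem_iff, spectrum.mem_iff, Matrix.isUnit_iff_isUnit_det,
      Matrix.isUnit_iff_isUnit_det, ← Matrix.det_transpose]
    simp [Matrix.algebraMap_eq_diagonal]
  simp only [spectralRadius, this]

theorem leftMulMatrix_one : R.leftMulMatrix R.one = 1 := by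
  ext k j
  simp [leftMulMatrix, R.one_mul, Matrix.one_apply, eq_comm]

theorem FPdim_one : R.FPdim R.one = 1 := by
  have : Nonempty I := ⟨R.one⟩
  simp [FPdim, leftMulMatrix_one, spectralRadius, spectrum.one_eq]

/-- The column sums of a nonnegative integer matrix without zero columns do not decrease under
taking powers, so that the matrix is not nilpotent. -/
theorem not_isNilpotent_leftMulMatrix (i : I) : ¬ IsNilpotent (R.leftMulMatrix i) := by
  let M : Matrix I I ℕ := Matrix.of fun k j => R.N i j k
  have hM : R.leftMulMatrix i = M.map (Nat.castRingHom ℂ) := by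
    ext k j; simp [leftMulMatrix, M]
  have hcol : ∀ j, 1 ≤ ∑ k, M k j := by
    intro j
    have h := R.assoc (R.dual i) i j j
    have h0 : R.N (R.dual i) i R.one * R.N R.one j j = 1 := by
      simp [R.one_mul, R.mul_coeff_one, R.dual_dual]
    have h1 : 1 ≤ ∑ m, R.N i j m * R.N (R.dual i) m j := by
      rw [← h, ← h0]
      exact Finset.single_le_sum
        (f := fun m => R.N (R.dual i) i m * R.N m j j) (fun _ _ => Nat.zero_le _)
        (Finset.mem_univ R.one)
    by_contra hlt
    have hz : ∀ k, R.N i j k = 0 := by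
      have : ∑ k, M k j = 0 := by omega
      intro k
      exact (Finset.sum_eq_zero_iff.mp this) k (Finset.mem_univ k)
    simp [hz] at h1
  have hpow : ∀ (n : ℕ) (j : I), 1 ≤ ∑ k, (M ^ n) k j := by
    intro n
    induction n with
    | zero => intro j; simp [Matrix.one_apply]
    | succ n ih =>
      intro j
      calc 1 ≤ ∑ k, M k j := hcol j
        _ ≤ ∑ m, (∑ k, (M ^ n) k m) * M m j :=
          Finset.sum_le_sum fun m _ => Nat.le_mul_of_pos_left _ (ih m)
        _ = ∑ k, (M ^ (n + 1)) k j := by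
          simp only [pow_succ, Matrix.mul_apply, Finset.sum_mul]
          exact Finset.sum_comm
  rintro ⟨n, hn⟩
  have h := hpow n R.one
  have hz : M ^ n = 0 := by
    have : (M ^ n).map (Nat.castRingHom ℂ) = 0 := by rw [Matrix.map_pow, ← hM, hn]
    ext a b
    have := congrFun (congrFun this a) b
    simpa using this
  simp [hz] at h

/-- By the Cayley-Hamilton theorem a complex matrix without nonzero eigenvalues is nilpotent. The
spectral radius is finite, so that its real value is not a junk value. -/
theorem FPdim_pos (i : I) : 0 < R.FPdim i := by
  have hfin : (spectrum ℂ (R.leftMulMatrix i)).Finite := Matrix.finite_spectrum _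
  refine ENNReal.toReal_pos ?_ ?_
  · intro h0
    apply R.not_isNilpotent_leftMulMatrix i
    have hs : ∀ z ∈ spectrum ℂ (R.leftMulMatrix i), z = 0 := by
      intro z hz
      have : (‖z‖₊ : ENNReal) ≤ 0 :=
        h0 ▸ le_iSup₂ (α := ENNReal) (f := fun k _ => (‖k‖₊ : ENNReal)) z hz
      simpa using this
    have hroots : ∀ z ∈ (R.leftMulMatrix i).charpoly.roots, z = 0 := by
      intro z hz
      apply hs
      rw [Matrix.mem_spectrum_iff_isRoot_charpoly]
      exact Polynomial.isRoot_of_mem_roots hz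
    have hsplit := IsAlgClosed.splits (R.leftMulMatrix i).charpoly
    have hX : (R.leftMulMatrix i).charpoly
        = Polynomial.X ^ (R.leftMulMatrix i).charpoly.roots.card := by
      conv_lhs => rw [hsplit.eq_prod_roots_of_monic (Matrix.charpoly_monic _)]
      rw [Multiset.eq_replicate_of_mem hroots]
      simp
    refine ⟨(R.leftMulMatrix i).charpoly.roots.card, ?_⟩
    have := Matrix.aeval_self_charpoly (R.leftMulMatrix i)
    rw [hX] at this
    simpa using this
  · have hle : spectralRadius ℂ (R.leftMulMatrix i) ≤ ∑ z ∈ hfin.toFinset, (‖z‖₊ : ENNReal) := by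
      refine iSup₂_le fun z hz => ?_
      exact Finset.single_le_sum (f := fun z : ℂ => (‖z‖₊ : ENNReal)) (fun _ _ => zero_le)
        (hfin.mem_toFinset.mpr hz)
    exact ne_top_of_le_ne_top (by simp) hle

end FusionRing

/-! ### Tetrahedral symbols and their unitary gauge -/

namespace FusionRing

variable {I : Type u} [Fintype I] [DecidableEq I] (R : FusionRing I)

/-- Spherical 6j-symbols over a fusion ring, in the gauge in which all symbols with a trivial
label at one of the positions `1, 2, 4, 5` are `1`: a dimension function `d`, the symbols `U`
with the pentagon equation, and the symbols `V` of the inverse recoupling matrices. Only those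
evaluations at trivial labels are recorded which enter the unit constraint, the duality and the
pivotal structure of the associated category. -/
structure SphericalSymbols where
  /-- the dimensions -/
  d : I → ℝ
  /-- the recoupling coefficients -/
  U : I → I → I → I → I → I → ℂ
  /-- the coefficients of the inverse recoupling -/
  V : I → I → I → I → I → I → ℂ
  d_pos : ∀ i, 0 < d i
  d_one : d R.one = 1
  d_dual : ∀ i, d (R.dual i) = d i
  U_zero : ∀ i₁ i₂ i₃ i₄ i₅ i₆, ¬ R.Admissible i₁ i₂ i₃ i₄ i₅ i₆ → U i₁ i₂ i₃ i₄ i₅ i₆ = 0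
  V_zero : ∀ i₁ i₂ i₃ i₄ i₅ i₆, ¬ R.Admissible i₁ i₂ i₃ i₄ i₅ i₆ → V i₁ i₂ i₃ i₄ i₅ i₆ = 0
  U_mul_V : ∀ i₁ i₂ i₃ i₃' i₄ i₅,
    ∑ x, U i₁ i₂ i₃ i₄ i₅ x * V i₁ i₂ i₃' i₄ i₅ x =
      if i₃ = i₃' ∧ R.N i₁ i₂ i₃ ≠ 0 ∧ R.N i₃ i₄ i₅ ≠ 0 then 1 else 0
  V_mul_U : ∀ i₁ i₂ i₄ i₅ i₆ i₆',
    ∑ x, U i₁ i₂ x i₄ i₅ i₆ * V i₁ i₂ x i₄ i₅ i₆' =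
      if i₆ = i₆' ∧ R.N i₂ i₄ i₆ ≠ 0 ∧ R.N i₁ i₆ i₅ ≠ 0 then 1 else 0
  pentagon : ∀ i₁ i₂ i₃ i₄ i₅ i₆ i₇ i₈ i₉,
    U i₂ i₇ i₈ i₉ i₃ i₁ * U i₅ i₄ i₂ i₁ i₃ i₆ =
      ∑ i₀, U i₅ i₄ i₂ i₇ i₈ i₀ * U i₅ i₀ i₈ i₉ i₃ i₆ * U i₄ i₇ i₀ i₉ i₆ i₁
  V_triangle : ∀ i j k, R.N i j k ≠ 0 → V i R.one i j k j = 1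
  V_snake : ∀ i, V i (R.dual i) R.one i i R.one = ((d i : ℂ))⁻¹
  V_nested : ∀ i j k, R.N i j k ≠ 0 →
    V (R.dual j) (R.dual i) (R.dual k) k R.one j = 1
  U_nested : ∀ i j k, R.N i j k ≠ 0 →
    U (R.dual i) i R.one j j k = ((√(d k) / (√(d i) * √(d j)) : ℝ) : ℂ)

/-- The symbols are unitary if the inverse recoupling is the conjugate one. -/
def SphericalSymbols.IsUnitary {R : FusionRing I} (S : R.SphericalSymbols) : Prop :=
  ∀ i₁ i₂ i₃ i₄ i₅ i₆, (starRingEnd ℂ) (S.U i₁ i₂ i₃ i₄ i₅ i₆) = S.V i₁ i₂ i₃ i₄ i₅ i₆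

section Tetra

variable {R} {T : I → I → I → I → I → I → ℂ} {d : I → ℝ}

namespace IsA4Symmetric

variable (h : R.IsA4Symmetric T)
include h

/-- The first generator permutes the positions `1`, `3`, `2` and `4`, `6`, `5` cyclically. -/
theorem rotate_fst (a b c e f g : I) : T a b c e f g = T b (R.dual c) (R.dual a) f g e :=
  (h a b c e f g).1

/-- The second generator permutes the positions `1`, `6`, `2` and `3`, `5`, `4` cyclically. -/
theorem rotate_snd (a b c e f g : I) :
    T a b c e f g = T (R.dual b) g e (R.dual f) (R.dual c) (R.dual a) :=
  (h a b c e f g).2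

/-- The rotation which moves the label at position `3` to position `4`, the position at which the
normalization evaluates a trivial label. -/
theorem move_three (a b c e f g : I) :
    T a b c e f g = T g (R.dual e) b (R.dual c) (R.dual a) (R.dual f) := by
  rw [h.rotate_snd, h.rotate_fst]; simp [R.dual_dual]

/-- The rotation which moves the label at position `6` to position `4`. -/
theorem move_six (a b c e f g : I) :
    T a b c e f g = T (R.dual c) a (R.dual b) g e f := by
  rw [h.rotate_fst, h.rotate_fst]; simp [R.dual_dual]

/-- A rotation exchanging the positions `3` and `6`. -/
theorem move_three_to_six (a b c e f g : I) :
    T a b c e f g = T (R.dual e) (R.dual b) (R.dual g) (R.dual a) (R.dual f) (R.dual c) := by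
  rw [h.rotate_fst, h.rotate_snd, h.rotate_snd]; simp [R.dual_dual]

/-- The rotation about the axis through the edges at the positions `3` and `6`. -/
theorem flip_pairs (a b c e f g : I) :
    T a b c e f g = T e (R.dual f) (R.dual c) a (R.dual b) (R.dual g) := by
  rw [h.rotate_fst, h.rotate_snd, h.rotate_fst]; simp [R.dual_dual]

/-- The mirror image of the tetrahedron which enters the inverse recoupling is, up to a rotation,
the one in which the reflection symmetry is formulated. -/
theorem mirror (a b c e f g : I) :
    T a g f (R.dual e) c b = T (R.dual a) c b e g f := by
  rw [h.rotate_fst, h.rotate_fst, h.rotate_snd]; simp [R.dual_dual]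

end IsA4Symmetric

variable (hA : R.IsA4Symmetric T)
  (hN : R.IsNormalized d T)
  (hdpos : ∀ i, 0 < d i) (hddual : ∀ i, d (R.dual i) = d i) (hdone : d R.one = 1)

theorem rpow_neg_half_mul {a b : ℝ} (ha : 0 < a) (hb : 0 < b) :
    a ^ (-(1 / 2) : ℝ) * b ^ (-(1 / 2) : ℝ) = (√(a * b))⁻¹ := by
  rw [← Real.mul_rpow ha.le hb.le, Real.sqrt_eq_rpow, Real.rpow_neg (mul_pos ha hb).le]

include hN hdpos in
theorem T_four_one {i j k : I} (h : R.N i j k ≠ 0) :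
    T i j k R.one k j = ((√(d j * d k) : ℝ) : ℂ)⁻¹ := by
  rw [hN i j k h, rpow_neg_half_mul (hdpos j) (hdpos k), Complex.ofReal_inv]

include hA hN hdpos hddual in
theorem T_three_one {a e g : I} (h : R.N a e g ≠ 0) :
    T (R.dual a) a R.one e e g = ((√(d a * d e) : ℝ) : ℂ)⁻¹ := by
  rw [hA.move_three, R.dual_dual, R.dual_one, T_four_one hN hdpos, hddual, mul_comm]
  rwa [← R.N_flip]

include hA hN hdpos hddual in
theorem T_six_one {a b c : I} (h : R.N a b c ≠ 0) :
    T a b c (R.dual b) a R.one = ((√(d a * d b) : ℝ) : ℂ)⁻¹ := by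
  rw [hA.move_six, T_four_one hN hdpos, hddual]
  rwa [R.N_rotate, R.dual_dual, R.dual_dual]

include hA hN hdpos hddual in
theorem T_five_one {a b c : I} (h : R.N a b c ≠ 0) :
    T a b c (R.dual c) R.one (R.dual a) = ((√(d a * d c) : ℝ) : ℂ)⁻¹ := by
  rw [hA.rotate_fst, T_four_one hN hdpos, hddual, hddual, mul_comm]
  rwa [← R.N_rotate]

/-- The pentagon equation for the tetrahedral symbols. -/
def TetraPentagon (T : I → I → I → I → I → I → ℂ) (d : I → ℝ) : Prop :=
  ∀ i₁ i₂ i₃ i₄ i₅ i₆ i₇ i₈ i₉,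
    T i₂ i₇ i₈ i₉ i₃ i₁ * T i₅ i₄ i₂ i₁ i₃ i₆ =
      ∑ i₀, (d i₀ : ℂ) * (T i₅ i₄ i₂ i₇ i₈ i₀ * T i₅ i₀ i₈ i₉ i₃ i₆ * T i₄ i₇ i₀ i₉ i₆ i₁)

variable (hP : TetraPentagon T d)
  (hZ : ∀ i₁ i₂ i₃ i₄ i₅ i₆, ¬ R.Admissible i₁ i₂ i₃ i₄ i₅ i₆ → T i₁ i₂ i₃ i₄ i₅ i₆ = 0)

include hA hN hdpos hddual hP hZ in
/-- Orthogonality of the tetrahedral symbols: this is the pentagon equation in which `i₁` is the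
trivial label, so that three of the five tetrahedra degenerate. -/
theorem tetra_orthogonality (a b c c' e f : I) :
    ∑ x, (d x : ℂ) * (T a b c e f x * T a x f (R.dual e) c' b) =
      if c = c' ∧ R.N a b c ≠ 0 ∧ R.N c e f ≠ 0 then ((d c : ℂ))⁻¹ else 0 := by
  have hP' := hP R.one c c' b a b e f (R.dual e)
  have hs : ∀ x, T a b c e f x * T b e x (R.dual e) b R.one
      = T a b c e f x * ((√(d b * d e) : ℝ) : ℂ)⁻¹ := by
    intro x
    by_cases hx : R.N b e x ≠ 0
    · rw [T_six_one hA hN hdpos hddual hx]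
    · rw [hZ a b c e f x fun h => hx h.2.2.1]; simp
  have hbe : ((√(d b * d e) : ℝ) : ℂ) ≠ 0 := by
    exact_mod_cast (Real.sqrt_pos.mpr (mul_pos (hdpos b) (hdpos e))).ne'
  have hL : ∑ x, (d x : ℂ) * (T a b c e f x * T a x f (R.dual e) c' b)
      = ((√(d b * d e) : ℝ) : ℂ) * (T c e f (R.dual e) c' R.one * T a b c R.one c' b) := by
    rw [hP', Finset.mul_sum]
    refine Finset.sum_congr rfl fun x _ => ?_
    rw [mul_right_comm (T a b c e f x), hs]
    field_simp
  rw [hL]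
  split_ifs with hc
  · obtain ⟨rfl, h1, h2⟩ := hc
    rw [T_six_one hA hN hdpos hddual h2, T_four_one hN hdpos h1]
    have h3 : √(d c * d e) * √(d b * d c) = √(d b * d e) * d c := by
      rw [← Real.sqrt_mul (mul_pos (hdpos c) (hdpos e)).le,
        show d c * d e * (d b * d c) = (d b * d e) * (d c * d c) by ring,
        Real.sqrt_mul (mul_pos (hdpos b) (hdpos e)).le, Real.sqrt_mul_self (hdpos c).le]
    rw [← mul_inv, ← Complex.ofReal_mul, h3, Complex.ofReal_mul, mul_inv, mul_inv_cancel_left₀ hbe]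
  · by_cases h1 : R.N a b c ≠ 0
    · by_cases h2 : R.N c e f ≠ 0
      · have h3 : c ≠ c' := fun h => hc ⟨h, h1, h2⟩
        rw [hZ a b c R.one c' b fun h => h3 (R.N_one_right_ne.mp h.2.1)]; simp
      · rw [hZ c e f _ _ _ fun h => h2 h.1]; simp
    · rw [hZ a b c _ _ _ fun h => h1 h.1]; simp

theorem admissible_mirror {a b c e f g : I} :
    R.Admissible a g f (R.dual e) c b ↔ R.Admissible a b c e f g := by
  unfold Admissible
  rw [← R.N_flip c e f, ← R.N_flip b e g]
  tauto

end Tetra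

/-- The symbols in the unitary gauge: `√(d i₃ d i₆)` times the tetrahedral symbols. -/
noncomputable def gaugeU (d : I → ℝ) (T : I → I → I → I → I → I → ℂ)
    (i₁ i₂ i₃ i₄ i₅ i₆ : I) : ℂ :=
  ((√(d i₃ * d i₆) : ℝ) : ℂ) * T i₁ i₂ i₃ i₄ i₅ i₆

/-- The inverse symbols in the unitary gauge: the tetrahedral symbols of the mirror image. -/
noncomputable def gaugeV (d : I → ℝ) (T : I → I → I → I → I → I → ℂ)
    (i₁ i₂ i₃ i₄ i₅ i₆ : I) : ℂ :=
  ((√(d i₃ * d i₆) : ℝ) : ℂ) * T i₁ i₆ i₅ (R.dual i₄) i₃ i₂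

section Gauge

variable {R} {T : I → I → I → I → I → I → ℂ} {d : I → ℝ}
  (hA : R.IsA4Symmetric T)
  (hN : R.IsNormalized d T)
  (hdpos : ∀ i, 0 < d i) (hddual : ∀ i, d (R.dual i) = d i) (hdone : d R.one = 1)
  (hP : TetraPentagon T d)
  (hZ : ∀ i₁ i₂ i₃ i₄ i₅ i₆, ¬ R.Admissible i₁ i₂ i₃ i₄ i₅ i₆ → T i₁ i₂ i₃ i₄ i₅ i₆ = 0)

include hA hN hdpos hddual hP hZ in
theorem gaugeU_mul_gaugeV (a b c c' e f : I) :
    ∑ x, gaugeU d T a b c e f x * R.gaugeV d T a b c' e f x =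
      if c = c' ∧ R.N a b c ≠ 0 ∧ R.N c e f ≠ 0 then 1 else 0 := by
  have h := tetra_orthogonality hA hN hdpos hddual hP hZ a b c c' e f
  have h1 : ∑ x, gaugeU d T a b c e f x * R.gaugeV d T a b c' e f x
      = ((√(d c) * √(d c') : ℝ) : ℂ) *
        ∑ x, (d x : ℂ) * (T a b c e f x * T a x f (R.dual e) c' b) := by
    rw [Finset.mul_sum]
    refine Finset.sum_congr rfl fun x _ => ?_
    unfold gaugeU gaugeV
    rw [Real.sqrt_mul (hdpos c).le, Real.sqrt_mul (hdpos c').le]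
    have h2 : (d x : ℂ) = ((√(d x) : ℝ) : ℂ) * ((√(d x) : ℝ) : ℂ) := by
      rw [← Complex.ofReal_mul, Real.mul_self_sqrt (hdpos x).le]
    rw [h2]
    push_cast
    ring
  rw [h1, h]
  split_ifs with hc
  · obtain ⟨rfl, -⟩ := hc
    rw [Real.mul_self_sqrt (hdpos c).le, mul_inv_cancel₀]
    exact_mod_cast (hdpos c).ne'
  · simp

include hA hN hdpos hddual hP hZ in
/-- The second orthogonality relation follows from the first by a rotation of the tetrahedron. -/
theorem gaugeV_mul_gaugeU (a b e f g g' : I) :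
    ∑ x, gaugeU d T a b x e f g * R.gaugeV d T a b x e f g' =
      if g = g' ∧ R.N b e g ≠ 0 ∧ R.N a g f ≠ 0 then 1 else 0 := by
  have h := gaugeU_mul_gaugeV hA hN hdpos hddual hP hZ
    (R.dual e) (R.dual b) (R.dual g) (R.dual g') (R.dual a) (R.dual f)
  have h1 : R.N (R.dual e) (R.dual b) (R.dual g) = R.N b e g := R.dual_mul _ _ _
  have h2 : R.N (R.dual g) (R.dual a) (R.dual f) = R.N a g f := R.dual_mul _ _ _
  simp only [h1, h2, R.dual_eq_iff] at h
  rw [← h, ← Equiv.sum_comp R.dualEquiv]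
  refine Finset.sum_congr rfl fun x _ => ?_
  change gaugeU d T _ _ (R.dual x) _ _ _ * R.gaugeV d T _ _ (R.dual x) _ _ _ = _
  unfold gaugeU gaugeV
  rw [hA.move_three_to_six a b (R.dual x) e f g, hA.flip_pairs a g' f (R.dual e) (R.dual x) b]
  simp only [hddual, R.dual_dual, mul_comm (d x)]

omit [DecidableEq I] in
include hdpos hP in
theorem gaugeU_pentagon (i₁ i₂ i₃ i₄ i₅ i₆ i₇ i₈ i₉ : I) :
    gaugeU d T i₂ i₇ i₈ i₉ i₃ i₁ * gaugeU d T i₅ i₄ i₂ i₁ i₃ i₆ =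
      ∑ i₀, gaugeU d T i₅ i₄ i₂ i₇ i₈ i₀ * gaugeU d T i₅ i₀ i₈ i₉ i₃ i₆ *
        gaugeU d T i₄ i₇ i₀ i₉ i₆ i₁ := by
  have h1 : gaugeU d T i₂ i₇ i₈ i₉ i₃ i₁ * gaugeU d T i₅ i₄ i₂ i₁ i₃ i₆ =
      ((√(d i₂) * √(d i₈) * √(d i₆) * √(d i₁) : ℝ) : ℂ) *
        (T i₂ i₇ i₈ i₉ i₃ i₁ * T i₅ i₄ i₂ i₁ i₃ i₆) := by
    unfold gaugeU
    rw [Real.sqrt_mul (hdpos _).le, Real.sqrt_mul (hdpos _).le]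
    push_cast
    ring
  rw [h1, hP, Finset.mul_sum]
  refine Finset.sum_congr rfl fun x _ => ?_
  have h2 : (d x : ℂ) = ((√(d x) : ℝ) : ℂ) * ((√(d x) : ℝ) : ℂ) := by
    rw [← Complex.ofReal_mul, Real.mul_self_sqrt (hdpos x).le]
  unfold gaugeU
  rw [h2, Real.sqrt_mul (hdpos _).le, Real.sqrt_mul (hdpos _).le, Real.sqrt_mul (hdpos _).le]
  push_cast
  ring

/-- The spherical 6j-symbols obtained from `A₄`-symmetric normalized tetrahedral symbols. -/
noncomputable def sphericalSymbols (hA : R.IsA4Symmetric T)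
    (hN : R.IsNormalized d T)
    (hdpos : ∀ i, 0 < d i) (hddual : ∀ i, d (R.dual i) = d i) (hdone : d R.one = 1)
    (hP : TetraPentagon T d)
    (hZ : ∀ i₁ i₂ i₃ i₄ i₅ i₆, ¬ R.Admissible i₁ i₂ i₃ i₄ i₅ i₆ →
      T i₁ i₂ i₃ i₄ i₅ i₆ = 0) : R.SphericalSymbols where
  d := d
  U := gaugeU d T
  V := R.gaugeV d T
  d_pos := hdpos
  d_one := hdone
  d_dual := hddual
  U_zero a b c e f g h := by rw [gaugeU, hZ _ _ _ _ _ _ h, mul_zero]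
  V_zero a b c e f g h := by
    rw [gaugeV, hZ _ _ _ _ _ _ (mt admissible_mirror.mp h), mul_zero]
  U_mul_V := gaugeU_mul_gaugeV hA hN hdpos hddual hP hZ
  V_mul_U := gaugeV_mul_gaugeU hA hN hdpos hddual hP hZ
  pentagon := gaugeU_pentagon hdpos hP
  V_triangle i j k h := by
    rw [gaugeV, T_six_one hA hN hdpos hddual h, mul_inv_cancel₀]
    exact_mod_cast (Real.sqrt_pos.mpr (mul_pos (hdpos i) (hdpos j))).ne'
  V_snake i := by
    have h := T_five_one (a := i) (b := R.one) (c := i) hA hN hdpos hddual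
      (R.N_one_right_ne.mpr rfl)
    rw [gaugeV, h, Real.sqrt_mul_self (hdpos i).le, hdone]
    simp
  V_nested i j k h := by
    have h1 : R.N j (R.dual k) (R.dual i) ≠ 0 := by rwa [← R.N_rotate]
    have h2 := T_three_one hA hN hdpos hddual h1
    rw [gaugeV, h2, hddual, mul_comm (d k), mul_inv_cancel₀]
    exact_mod_cast (Real.sqrt_pos.mpr (mul_pos (hdpos j) (hdpos k))).ne'
  U_nested i j k h := by
    rw [gaugeU, T_three_one hA hN hdpos hddual h, hdone, _root_.one_mul,
      Real.sqrt_mul (hdpos i).le]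
    push_cast
    rw [div_eq_mul_inv]

/-- The reflection symmetry says that the inverse symbols are the conjugate ones. -/
theorem sphericalSymbols_isUnitary (hR : R.IsReflectionSymmetric T) :
    (sphericalSymbols hA hN hdpos hddual hdone hP hZ).IsUnitary := by
  intro a b c e f g
  change (starRingEnd ℂ) (gaugeU d T a b c e f g) = R.gaugeV d T a b c e f g
  rw [gaugeU, gaugeV, map_mul, Complex.conj_ofReal, hR, hA.mirror]

end Gauge

theorem tetraPentagon_tetra {R : FusionRing I} {F : I → I → I → I → I → I → ℂ} {d : I → ℝ}
    (hdpos : ∀ i, 0 < d i) (hF : R.IsPentagonSolution F) :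
    TetraPentagon (tetra d F) d := by
  intro i₁ i₂ i₃ i₄ i₅ i₆ i₇ i₈ i₉
  have h0 : ∀ i, (d i : ℂ) ≠ 0 := fun i => by exact_mod_cast (hdpos i).ne'
  simp only [tetra]
  rw [show ((d i₁ : ℂ)⁻¹ * F i₂ i₇ i₈ i₉ i₃ i₁) * ((d i₆ : ℂ)⁻¹ * F i₅ i₄ i₂ i₁ i₃ i₆) =
    (d i₁ : ℂ)⁻¹ * (d i₆ : ℂ)⁻¹ * (F i₂ i₇ i₈ i₉ i₃ i₁ * F i₅ i₄ i₂ i₁ i₃ i₆) by ring,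
    hF.pentagon, Finset.mul_sum]
  refine Finset.sum_congr rfl fun x _ => ?_
  have := h0 x
  field_simp

end FusionRing

/-! ### The semisimple category over the fusion rules -/

/-- Codes for the finite index sets of direct sums of simple objects. Codes are used instead of
types in order that the category built from them is small. -/
inductive IndexCode : Type
  | point : IndexCode
  | fin (n : ℕ) : IndexCode
  | triple (a b : IndexCode) : IndexCode

/-- The index set of a code. The indices of a tensor product are the triples of an index of each
factor and a label, the label of a simple constituent of the product. -/
def IndexCode.El (I : Type u) : IndexCode → Type u
  | point => PUnit
  | fin n => ULift (Fin n)
  | triple a b => a.El I × b.El I × I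

instance IndexCode.fintype (I : Type u) [Fintype I] : ∀ c : IndexCode, Fintype (c.El I)
  | point => inferInstanceAs (Fintype PUnit)
  | fin n => inferInstanceAs (Fintype (ULift (Fin n)))
  | triple a b =>
    let _ := IndexCode.fintype I a
    let _ := IndexCode.fintype I b
    inferInstanceAs (Fintype (a.El I × b.El I × I))

noncomputable instance (I : Type u) (c : IndexCode) : DecidableEq (c.El I) := Classical.decEq _

namespace FusionRing

variable {I : Type u} [Fintype I] [DecidableEq I] {R : FusionRing I}

namespace SphericalSymbols

/-- An object of the category of `S`: the formal direct sum of the simple objects `color x`, where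
`x` runs through the indices in `supp`. Indices outside `supp` contribute nothing; they allow
the index set of a tensor product to be a full product. -/
structure Obj (S : R.SphericalSymbols) where
  /-- the code of the index set -/
  code : IndexCode
  /-- the label of the simple summand at an index -/
  color : code.El I → I
  /-- the indices of the summands -/
  supp : code.El I → Prop

variable {S : R.SphericalSymbols}

namespace Obj

/-- The indices of an object. -/
abbrev Idx (X : S.Obj) : Type u := X.code.El I

/-- The morphisms: matrices supported on pairs of indices of the same simple summand. -/
def homSubmodule (X Y : S.Obj) : Submodule ℂ (X.Idx → Y.Idx → ℂ) where
  carrier := {f | ∀ x y, ¬ (X.supp x ∧ Y.supp y ∧ X.color x = Y.color y) → f x y = 0}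
  add_mem' hf hg x y h := by simp [hf x y h, hg x y h]
  zero_mem' x y _ := rfl
  smul_mem' c f hf x y h := by simp [hf x y h]

open Classical in
noncomputable instance : Category.{u} S.Obj where
  Hom X Y := homSubmodule X Y
  id X := ⟨fun x y => if x = y ∧ X.supp x then 1 else 0, fun x y h => if_neg fun ⟨h1, h2⟩ =>
    h ⟨h2, h1 ▸ h2, h1 ▸ rfl⟩⟩
  comp {X Y Z} f g := ⟨fun x z => ∑ y, f.1 x y * g.1 y z, fun x z h =>
    Finset.sum_eq_zero fun y _ => by
      by_cases h1 : X.supp x ∧ Y.supp y ∧ X.color x = Y.color y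
      · rw [g.2 y z fun h2 => h ⟨h1.1, h2.2.1, h1.2.2.trans h2.2.2⟩, mul_zero]
      · rw [f.2 x y h1, zero_mul]⟩
  id_comp {X Y} f := by
    apply Subtype.ext
    funext x y
    by_cases h : X.supp x
    · simp [h]
    · simp [h, f.2 x y fun h1 => h h1.1]
  comp_id {X Y} f := by
    apply Subtype.ext
    funext x y
    by_cases h : Y.supp y
    · have : ∀ z, (if z = y ∧ Y.supp z then (1 : ℂ) else 0) = if z = y then 1 else 0 := by
        intro z; by_cases hz : z = y <;> simp [hz, h]
      simp [this]
    · have : ∀ z, (if z = y ∧ Y.supp z then (1 : ℂ) else 0) = 0 := by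
        intro z; by_cases hz : z = y <;> simp [hz, h]
      simp [this, f.2 x y fun h1 => h h1.2.1]
  assoc f g h := by
    apply Subtype.ext
    funext x w
    simp only [Finset.sum_mul, Finset.mul_sum, mul_assoc]
    exact Finset.sum_comm

instance (X Y : S.Obj) : AddCommGroup (X ⟶ Y) := inferInstanceAs (AddCommGroup (homSubmodule X Y))
instance (X Y : S.Obj) : Module ℂ (X ⟶ Y) := inferInstanceAs (Module ℂ (homSubmodule X Y))
instance (X Y : S.Obj) : FiniteDimensional ℂ (X ⟶ Y) :=
  inferInstanceAs (FiniteDimensional ℂ (homSubmodule X Y))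

/-- The matrix entries of a morphism. -/
def entry {X Y : S.Obj} (f : X ⟶ Y) (x : X.Idx) (y : Y.Idx) : ℂ := f.1 x y

/-- The morphism with given matrix entries. -/
def homMk {X Y : S.Obj} (f : X.Idx → Y.Idx → ℂ)
    (hf : ∀ x y, ¬ (X.supp x ∧ Y.supp y ∧ X.color x = Y.color y) → f x y = 0) : X ⟶ Y :=
  ⟨f, hf⟩

section Entries

variable {X Y Z : S.Obj}

@[simp]
theorem entry_homMk (f : X.Idx → Y.Idx → ℂ) (hf) (x : X.Idx) (y : Y.Idx) :
    entry (homMk f hf) x y = f x y := rfl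

theorem hom_ext {f g : X ⟶ Y} (h : ∀ x y, entry f x y = entry g x y) : f = g :=
  Subtype.ext (funext fun x => funext fun y => h x y)

theorem entry_eq_zero (f : X ⟶ Y) {x : X.Idx} {y : Y.Idx}
    (h : ¬ (X.supp x ∧ Y.supp y ∧ X.color x = Y.color y)) : entry f x y = 0 := f.2 x y h

theorem entry_comp (f : X ⟶ Y) (g : Y ⟶ Z) (x : X.Idx) (z : Z.Idx) :
    entry (f ≫ g) x z = ∑ y, entry f x y * entry g y z := rfl

open Classical in
theorem entry_id (x y : X.Idx) :
    entry (𝟙 X) x y = if x = y ∧ X.supp x then 1 else 0 := rfl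

@[simp] theorem entry_add (f g : X ⟶ Y) (x : X.Idx) (y : Y.Idx) :
    entry (f + g) x y = entry f x y + entry g x y := rfl

@[simp] theorem entry_zero (x : X.Idx) (y : Y.Idx) : entry (0 : X ⟶ Y) x y = 0 := rfl

@[simp] theorem entry_smul (c : ℂ) (f : X ⟶ Y) (x : X.Idx) (y : Y.Idx) :
    entry (c • f) x y = c * entry f x y := rfl

@[simp] theorem entry_sum {J : Type*} (s : Finset J) (f : J → (X ⟶ Y)) (x : X.Idx) (y : Y.Idx) :
    entry (∑ j ∈ s, f j) x y = ∑ j ∈ s, entry (f j) x y := by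
  classical
  induction s using Finset.induction_on with
  | empty => simp
  | insert a s ha ih => rw [Finset.sum_insert ha, Finset.sum_insert ha, entry_add, ih]

end Entries

instance : Preadditive S.Obj where
  homGroup := inferInstance
  add_comp X Y Z f g h := hom_ext fun x y => by
    simp [entry_comp, add_mul, Finset.sum_add_distrib]
  comp_add X Y Z f g h := hom_ext fun x y => by
    simp [entry_comp, mul_add, Finset.sum_add_distrib]

instance : Linear ℂ S.Obj where
  homModule := inferInstance
  smul_comp X Y Z c f g := hom_ext fun x y => by
    simp [entry_comp, Finset.mul_sum, mul_assoc]
  comp_smul X Y Z f c g := hom_ext fun x y => by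
    simp [entry_comp, Finset.mul_sum, mul_left_comm]

/-- A function on the indices of `X` which vanishes outside the summands of `X`. -/
def IsSupported (X : S.Obj) (g : X.Idx → ℂ) : Prop := ∀ x, ¬ X.supp x → g x = 0

theorem isSupported_entry {X Y : S.Obj} (f : X ⟶ Y) (y : Y.Idx) :
    X.IsSupported fun x => entry f x y := fun _ h => entry_eq_zero f fun h1 => h h1.1

theorem IsSupported.const_mul {X : S.Obj} {g : X.Idx → ℂ} (hg : X.IsSupported g) (c : ℂ) :
    X.IsSupported fun x => c * g x := fun x h => by simp [hg x h]

/-- The identity matrix is zero outside the support, so that it only acts as the identity on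
functions which are supported. -/
theorem sum_entry_id {X : S.Obj} {g : X.Idx → ℂ} (hg : X.IsSupported g) (x : X.Idx) :
    ∑ y, entry (𝟙 X) x y * g y = g x := by
  classical
  by_cases h : X.supp x
  · simp [entry_id, h]
  · simp [entry_id, h, hg x h]

theorem entry_id_comm {X : S.Obj} (x y : X.Idx) : entry (𝟙 X) x y = entry (𝟙 X) y x := by
  classical
  rw [entry_id, entry_id]
  exact if_congr ⟨fun h => ⟨h.1.symm, h.1 ▸ h.2⟩, fun h => ⟨h.1.symm, h.1 ▸ h.2⟩⟩ rfl rfl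

theorem sum_mul_entry_id {X : S.Obj} {g : X.Idx → ℂ} (hg : X.IsSupported g) (x : X.Idx) :
    ∑ y, entry (𝟙 X) y x * g y = g x := by
  simp only [entry_id_comm _ x, sum_entry_id hg]

theorem color_eq {X Y : S.Obj} {f : X ⟶ Y} {x : X.Idx} {y : Y.Idx} (h : entry f x y ≠ 0) :
    X.color x = Y.color y := by
  by_contra hc
  exact h (entry_eq_zero f fun h1 => hc h1.2.2)

end Obj

end SphericalSymbols

end FusionRing

/-! ### The monoidal structure -/

namespace FusionRing.SphericalSymbols.Obj

variable {I : Type u} [Fintype I] [DecidableEq I] {R : FusionRing I} {S : R.SphericalSymbols}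

/-- The simple object with label `i`. -/
def simple (S : R.SphericalSymbols) (i : I) : S.Obj := ⟨.point, fun _ => i, fun _ => True⟩

/-- The tensor product: for each pair of summands, one summand for each label of the fusion
product. -/
def tensor (X Y : S.Obj) : S.Obj where
  code := .triple X.code Y.code
  color := fun p => p.2.2
  supp := fun p => X.supp p.1 ∧ Y.supp p.2.1 ∧ R.N (X.color p.1) (Y.color p.2.1) p.2.2 ≠ 0

/-- The tensor product of morphisms. -/
noncomputable def tensorMap {X Y X' Y' : S.Obj} (f : X ⟶ Y) (g : X' ⟶ Y') :
    X.tensor X' ⟶ Y.tensor Y' :=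
  homMk (fun p q => if p.2.2 = q.2.2 ∧ R.N (X.color p.1) (X'.color p.2.1) p.2.2 ≠ 0
    then entry f p.1 q.1 * entry g p.2.1 q.2.1 else 0) (by
  rintro ⟨x, x', k⟩ ⟨y, y', k'⟩ h
  by_contra h0
  simp only [ite_eq_right_iff, mul_eq_zero, not_forall, not_or] at h0
  obtain ⟨⟨rfl, hN⟩, hf, hg⟩ := h0
  have h1 : X.supp x ∧ Y.supp y ∧ X.color x = Y.color y := by
    by_contra h1; exact hf (entry_eq_zero f h1)
  have h2 : X'.supp x' ∧ Y'.supp y' ∧ X'.color x' = Y'.color y' := by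
    by_contra h2; exact hg (entry_eq_zero g h2)
  refine h ⟨⟨h1.1, h2.1, hN⟩, ⟨h1.2.1, h2.2.1, ?_⟩, rfl⟩
  rw [← h1.2.2, ← h2.2.2]
  exact hN)

open Classical in
/-- The associator, given by the inverse recoupling coefficients. -/
noncomputable def assocHom (X Y Z : S.Obj) :
    (X.tensor Y).tensor Z ⟶ X.tensor (Y.tensor Z) :=
  homMk (fun p q => if (p.1.1 = q.1 ∧ p.1.2.1 = q.2.1.1 ∧ p.2.1 = q.2.1.2.1 ∧ p.2.2 = q.2.2) ∧
      X.supp p.1.1 ∧ Y.supp p.1.2.1 ∧ Z.supp p.2.1 then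
    S.V (X.color p.1.1) (Y.color p.1.2.1) p.1.2.2 (Z.color p.2.1) p.2.2 q.2.1.2.2 else 0) (by
  rintro ⟨⟨x, y, m⟩, z, k⟩ ⟨x', ⟨y', z', n⟩, k'⟩ h
  by_contra h0
  simp only [ite_eq_right_iff, not_forall] at h0
  obtain ⟨⟨⟨rfl, rfl, rfl, rfl⟩, hx, hy, hz⟩, h0⟩ := h0
  by_cases ha : R.Admissible (X.color x) (Y.color y) m (Z.color z) k n
  · exact h ⟨⟨⟨hx, hy, ha.1⟩, hz, ha.2.1⟩, ⟨hx, ⟨hy, hz, ha.2.2.1⟩, ha.2.2.2⟩, rfl⟩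
  · exact h0 (S.V_zero _ _ _ _ _ _ ha))

open Classical in
/-- The inverse of the associator, given by the recoupling coefficients. -/
noncomputable def assocInv (X Y Z : S.Obj) :
    X.tensor (Y.tensor Z) ⟶ (X.tensor Y).tensor Z :=
  homMk (fun q p => if (q.1 = p.1.1 ∧ q.2.1.1 = p.1.2.1 ∧ q.2.1.2.1 = p.2.1 ∧ q.2.2 = p.2.2) ∧
      X.supp q.1 ∧ Y.supp q.2.1.1 ∧ Z.supp q.2.1.2.1 then
    S.U (X.color q.1) (Y.color q.2.1.1) p.1.2.2 (Z.color q.2.1.2.1) q.2.2 q.2.1.2.2 else 0) (by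
  rintro ⟨x', ⟨y', z', n⟩, k'⟩ ⟨⟨x, y, m⟩, z, k⟩ h
  by_contra h0
  simp only [ite_eq_right_iff, not_forall] at h0
  obtain ⟨⟨⟨rfl, rfl, rfl, rfl⟩, hx, hy, hz⟩, h0⟩ := h0
  by_cases ha : R.Admissible (X.color x') (Y.color y') m (Z.color z') k' n
  · exact h ⟨⟨hx, ⟨hy, hz, ha.2.2.1⟩, ha.2.2.2⟩, ⟨⟨hx, hy, ha.1⟩, hz, ha.2.1⟩, rfl⟩
  · exact h0 (S.U_zero _ _ _ _ _ _ ha))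

/-- An index of the tensor product. -/
def pair {X Y : S.Obj} (x : X.Idx) (y : Y.Idx) (k : I) : (X.tensor Y).Idx := (x, y, k)

theorem exists_pair {X Y : S.Obj} (p : (X.tensor Y).Idx) : ∃ x y k, p = pair x y k :=
  ⟨p.1, p.2.1, p.2.2, rfl⟩

theorem pair_inj {X Y : S.Obj} {x x' : X.Idx} {y y' : Y.Idx} {k k' : I} :
    pair x y k = pair x' y' k' ↔ x = x' ∧ y = y' ∧ k = k' := by
  simp only [pair]
  exact (Prod.mk.injEq _ _ _ _).to_iff.trans (and_congr Iff.rfl (Prod.mk.injEq _ _ _ _).to_iff)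

theorem sum_pair {X Y : S.Obj} {M : Type*} [AddCommMonoid M] (g : (X.tensor Y).Idx → M) :
    ∑ p, g p = ∑ x, ∑ y, ∑ k, g (pair x y k) :=
  (Fintype.sum_prod_type (α₁ := X.Idx) (α₂ := Y.Idx × I) g).trans
    (Finset.sum_congr rfl fun _ _ => Fintype.sum_prod_type _)

theorem supp_pair {X Y : S.Obj} {x : X.Idx} {y : Y.Idx} {k : I} :
    (X.tensor Y).supp (pair x y k) ↔ X.supp x ∧ Y.supp y ∧ R.N (X.color x) (Y.color y) k ≠ 0 :=
  Iff.rfl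

theorem color_pair {X Y : S.Obj} (x : X.Idx) (y : Y.Idx) (k : I) :
    (X.tensor Y).color (pair x y k) = k := rfl

theorem IsSupported.pair_left {X Y : S.Obj} {g : (X.tensor Y).Idx → ℂ}
    (hg : (X.tensor Y).IsSupported g) (y : Y.Idx) (k : I) :
    X.IsSupported fun x => g (pair x y k) := fun _ h => hg _ fun h1 => h h1.1

theorem IsSupported.pair_right {X Y : S.Obj} {g : (X.tensor Y).Idx → ℂ}
    (hg : (X.tensor Y).IsSupported g) (x : X.Idx) (k : I) :
    Y.IsSupported fun y => g (pair x y k) := fun _ h => hg _ fun h1 => h h1.2.1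

theorem entry_tensorMap {X Y X' Y' : S.Obj} (f : X ⟶ Y) (g : X' ⟶ Y')
    (x : X.Idx) (x' : X'.Idx) (k : I) (y : Y.Idx) (y' : Y'.Idx) (k' : I) :
    entry (tensorMap f g) (pair x x' k) (pair y y' k') =
      if k = k' ∧ R.N (X.color x) (X'.color x') k ≠ 0 then entry f x y * entry g x' y' else 0 :=
  rfl

open Classical in
theorem entry_assocHom {X Y Z : S.Obj} (x : X.Idx) (y : Y.Idx) (m : I) (z : Z.Idx) (k : I)
    (x' : X.Idx) (y' : Y.Idx) (z' : Z.Idx) (n : I) (k' : I) :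
    entry (assocHom X Y Z) (pair (pair x y m) z k) (pair x' (pair y' z' n) k') =
      if (x = x' ∧ y = y' ∧ z = z' ∧ k = k') ∧ X.supp x ∧ Y.supp y ∧ Z.supp z then
        S.V (X.color x) (Y.color y) m (Z.color z) k n else 0 := rfl

open Classical in
theorem entry_assocInv {X Y Z : S.Obj} (x : X.Idx) (y : Y.Idx) (m : I) (z : Z.Idx) (k : I)
    (x' : X.Idx) (y' : Y.Idx) (z' : Z.Idx) (n : I) (k' : I) :
    entry (assocInv X Y Z) (pair x' (pair y' z' n) k') (pair (pair x y m) z k) =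
      if (x' = x ∧ y' = y ∧ z' = z ∧ k' = k) ∧ X.supp x' ∧ Y.supp y' ∧ Z.supp z' then
        S.U (X.color x') (Y.color y') m (Z.color z') k' n else 0 := rfl

section Sums

theorem sum_entry_tensorMap {X Y X' Y' : S.Obj} (f : X ⟶ Y) (g : X' ⟶ Y')
    {h : (Y.tensor Y').Idx → ℂ} (hh : (Y.tensor Y').IsSupported h)
    (x : X.Idx) (x' : X'.Idx) (k : I) :
    ∑ q, entry (tensorMap f g) (pair x x' k) q * h q =
      ∑ y, ∑ y', entry f x y * entry g x' y' * h (pair y y' k) := by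
  rw [sum_pair]
  refine Finset.sum_congr rfl fun y _ => Finset.sum_congr rfl fun y' _ => ?_
  simp only [entry_tensorMap, ite_and, ite_mul, zero_mul, Finset.sum_ite_eq, Finset.mem_univ,
    if_true]
  split_ifs with hN
  · rfl
  · by_cases hf : entry f x y = 0
    · simp [hf]
    by_cases hg : entry g x' y' = 0
    · simp [hg]
    rw [hh, mul_zero]
    rw [supp_pair, ← color_eq hf, ← color_eq hg]
    exact fun h1 => hN h1.2.2

theorem sum_entry_assocHom {X Y Z : S.Obj} {h : (X.tensor (Y.tensor Z)).Idx → ℂ}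
    (hh : (X.tensor (Y.tensor Z)).IsSupported h)
    (x : X.Idx) (y : Y.Idx) (m : I) (z : Z.Idx) (k : I) :
    ∑ q, entry (assocHom X Y Z) (pair (pair x y m) z k) q * h q =
      ∑ n, S.V (X.color x) (Y.color y) m (Z.color z) k n * h (pair x (pair y z n) k) := by
  classical
  simp only [sum_pair]
  by_cases hs : X.supp x ∧ Y.supp y ∧ Z.supp z
  · simp only [entry_assocHom, hs, and_true, ite_and, ite_mul, zero_mul]
    simp only [Finset.sum_ite_eq, Finset.sum_ite_irrel, Finset.sum_const_zero,
      Finset.mem_univ, if_true]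
  · rw [Finset.sum_eq_zero, Finset.sum_eq_zero]
    · intro n _
      rw [hh, mul_zero]
      exact fun h1 => hs ⟨h1.1, h1.2.1.1, h1.2.1.2.1⟩
    · intro x' _
      simp [entry_assocHom, hs]

theorem sum_entry_assocInv {X Y Z : S.Obj} {h : ((X.tensor Y).tensor Z).Idx → ℂ}
    (hh : ((X.tensor Y).tensor Z).IsSupported h)
    (x : X.Idx) (y : Y.Idx) (z : Z.Idx) (n k : I) :
    ∑ q, entry (assocInv X Y Z) (pair x (pair y z n) k) q * h q =
      ∑ m, S.U (X.color x) (Y.color y) m (Z.color z) k n * h (pair (pair x y m) z k) := by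
  classical
  simp only [sum_pair]
  by_cases hs : X.supp x ∧ Y.supp y ∧ Z.supp z
  · simp only [entry_assocInv, hs, and_true, ite_and, ite_mul, zero_mul]
    simp only [Finset.sum_ite_eq, Finset.sum_ite_irrel, Finset.sum_const_zero,
      Finset.mem_univ, if_true]
  · rw [Finset.sum_eq_zero, Finset.sum_eq_zero]
    · intro n _
      rw [hh, mul_zero]
      exact fun h1 => hs ⟨h1.1.1, h1.1.2.1, h1.2.1⟩
    · intro x' _
      simp [entry_assocInv, hs]

end Sums

end FusionRing.SphericalSymbols.Obj

namespace FusionRing.SphericalSymbols.Obj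

variable {I : Type u} [Fintype I] [DecidableEq I] {R : FusionRing I} {S : R.SphericalSymbols}

/-- The index of the only summand of a simple object. -/
def point (S : R.SphericalSymbols) (i : I) : (simple S i).Idx := PUnit.unit

theorem sum_point {i : I} {M : Type*} [AddCommMonoid M] (g : (simple S i).Idx → M) :
    ∑ x, g x = g (point S i) := Fintype.sum_unique (ι := PUnit) g

theorem supp_point (i : I) : (simple S i).supp (point S i) := trivial

theorem color_point (i : I) : (simple S i).color (point S i) = i := rfl

/-- The matrix of the left unitor. -/
noncomputable def leftHom (X : S.Obj) : (simple S R.one).tensor X ⟶ X :=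
  homMk (fun p x => if p.2.2 = X.color p.2.1 then entry (𝟙 X) p.2.1 x else 0) (by
  rintro ⟨⟨⟩, x, k⟩ x' h
  by_contra h0
  simp only [ite_eq_right_iff, not_forall] at h0
  obtain ⟨rfl, h0⟩ := h0
  have h1 : X.supp x ∧ X.supp x' ∧ X.color x = X.color x' := by
    by_contra h1; exact h0 (entry_eq_zero _ h1)
  exact h ⟨⟨trivial, h1.1, R.N_one_left_ne.mpr rfl⟩, h1.2.1, h1.2.2⟩)

/-- The matrix of the inverse of the left unitor. -/
noncomputable def leftInv (X : S.Obj) : X ⟶ (simple S R.one).tensor X :=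
  homMk (fun x p => if p.2.2 = X.color x then entry (𝟙 X) x p.2.1 else 0) (by
  rintro x' ⟨⟨⟩, x, k⟩ h
  by_contra h0
  simp only [ite_eq_right_iff, not_forall] at h0
  obtain ⟨rfl, h0⟩ := h0
  have h1 : X.supp x' ∧ X.supp x ∧ X.color x' = X.color x := by
    by_contra h1; exact h0 (entry_eq_zero _ h1)
  exact h ⟨h1.1, ⟨trivial, h1.2.1, R.N_one_left_ne.mpr h1.2.2.symm⟩, rfl⟩)

/-- The matrix of the right unitor. -/
noncomputable def rightHom (X : S.Obj) : X.tensor (simple S R.one) ⟶ X :=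
  homMk (fun p x => if p.2.2 = X.color p.1 then entry (𝟙 X) p.1 x else 0) (by
  rintro ⟨x, ⟨⟩, k⟩ x' h
  by_contra h0
  simp only [ite_eq_right_iff, not_forall] at h0
  obtain ⟨rfl, h0⟩ := h0
  have h1 : X.supp x ∧ X.supp x' ∧ X.color x = X.color x' := by
    by_contra h1; exact h0 (entry_eq_zero _ h1)
  exact h ⟨⟨h1.1, trivial, R.N_one_right_ne.mpr rfl⟩, h1.2.1, h1.2.2⟩)

/-- The matrix of the inverse of the right unitor. -/
noncomputable def rightInv (X : S.Obj) : X ⟶ X.tensor (simple S R.one) :=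
  homMk (fun x p => if p.2.2 = X.color x then entry (𝟙 X) x p.1 else 0) (by
  rintro x' ⟨x, ⟨⟩, k⟩ h
  by_contra h0
  simp only [ite_eq_right_iff, not_forall] at h0
  obtain ⟨rfl, h0⟩ := h0
  have h1 : X.supp x' ∧ X.supp x ∧ X.color x' = X.color x := by
    by_contra h1; exact h0 (entry_eq_zero _ h1)
  exact h ⟨h1.1, ⟨h1.2.1, trivial, R.N_one_right_ne.mpr h1.2.2.symm⟩, rfl⟩)

theorem entry_leftHom {X : S.Obj} (u : (simple S R.one).Idx) (x : X.Idx) (k : I) (x' : X.Idx) :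
    entry (leftHom X) (pair u x k) x' = if k = X.color x then entry (𝟙 X) x x' else 0 := rfl

theorem entry_leftInv {X : S.Obj} (u : (simple S R.one).Idx) (x : X.Idx) (k : I) (x' : X.Idx) :
    entry (leftInv X) x' (pair u x k) = if k = X.color x' then entry (𝟙 X) x' x else 0 := rfl

theorem entry_rightHom {X : S.Obj} (u : (simple S R.one).Idx) (x : X.Idx) (k : I) (x' : X.Idx) :
    entry (rightHom X) (pair x u k) x' = if k = X.color x then entry (𝟙 X) x x' else 0 := rfl

theorem entry_rightInv {X : S.Obj} (u : (simple S R.one).Idx) (x : X.Idx) (k : I) (x' : X.Idx) :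
    entry (rightInv X) x' (pair x u k) = if k = X.color x' then entry (𝟙 X) x' x else 0 := rfl

theorem sum_entry_leftHom {X : S.Obj} {h : X.Idx → ℂ} (hh : X.IsSupported h)
    (u : (simple S R.one).Idx) (x : X.Idx) (k : I) :
    ∑ q, entry (leftHom X) (pair u x k) q * h q = if k = X.color x then h x else 0 := by
  simp only [entry_leftHom, ite_mul, zero_mul, Finset.sum_ite_irrel, sum_entry_id hh,
    Finset.sum_const_zero]

theorem sum_entry_rightHom {X : S.Obj} {h : X.Idx → ℂ} (hh : X.IsSupported h)
    (u : (simple S R.one).Idx) (x : X.Idx) (k : I) :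
    ∑ q, entry (rightHom X) (pair x u k) q * h q = if k = X.color x then h x else 0 := by
  simp only [entry_rightHom, ite_mul, zero_mul, Finset.sum_ite_irrel, sum_entry_id hh,
    Finset.sum_const_zero]

theorem sum_entry_leftInv {X : S.Obj} {h : ((simple S R.one).tensor X).Idx → ℂ}
    (hh : ((simple S R.one).tensor X).IsSupported h) (x : X.Idx) :
    ∑ q, entry (leftInv X) x q * h q = h (pair (point S R.one) x (X.color x)) := by
  rw [sum_pair, sum_point]
  simp only [entry_leftInv, ite_mul, zero_mul, Finset.sum_ite_eq', Finset.mem_univ, if_true]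
  exact sum_entry_id (hh.pair_right _ _) x

theorem sum_entry_rightInv {X : S.Obj} {h : (X.tensor (simple S R.one)).Idx → ℂ}
    (hh : (X.tensor (simple S R.one)).IsSupported h) (x : X.Idx) :
    ∑ q, entry (rightInv X) x q * h q = h (pair x (point S R.one) (X.color x)) := by
  rw [sum_pair]
  simp only [sum_point, entry_rightInv, ite_mul, zero_mul, Finset.sum_ite_eq', Finset.mem_univ,
    if_true]
  exact sum_entry_id (hh.pair_left _ _) x

section Coherence

theorem tensorMap_id (X Y : S.Obj) : tensorMap (𝟙 X) (𝟙 Y) = 𝟙 (X.tensor Y) := by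
  classical
  refine hom_ext fun p q => ?_
  obtain ⟨x, y, k, rfl⟩ := exists_pair p
  obtain ⟨x', y', k', rfl⟩ := exists_pair q
  simp only [entry_tensorMap, entry_id, pair_inj, supp_pair]
  grind

theorem tensorMap_comp {X Y Z X' Y' Z' : S.Obj} (f : X ⟶ Y) (f' : X' ⟶ Y') (g : Y ⟶ Z)
    (g' : Y' ⟶ Z') : tensorMap f f' ≫ tensorMap g g' = tensorMap (f ≫ g) (f' ≫ g') := by
  refine hom_ext fun p q => ?_
  obtain ⟨x, x', k, rfl⟩ := exists_pair p
  obtain ⟨z, z', k', rfl⟩ := exists_pair q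
  rw [entry_comp, sum_pair, entry_tensorMap]
  simp only [entry_tensorMap, ite_and, ite_mul, zero_mul, Finset.sum_ite_eq, Finset.mem_univ,
    if_true]
  by_cases hk : k = k'
  · subst hk
    by_cases hN : R.N (X.color x) (X'.color x') k ≠ 0
    · simp only [if_pos hN, if_true]
      rw [entry_comp, entry_comp, Finset.sum_mul_sum]
      refine Finset.sum_congr rfl fun y _ => Finset.sum_congr rfl fun y' _ => ?_
      by_cases hf : entry f x y = 0
      · simp [hf]
      by_cases hg : entry f' x' y' = 0
      · simp [hg]
      rw [← color_eq hf, ← color_eq hg]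
      rw [if_pos hN]
      ring
    · simp [hN]
  · simp [hk]

theorem comp_tensorMap {X Y X' Y' Z : S.Obj} (f : X ⟶ Y) (g : X' ⟶ Y') (h : Y.tensor Y' ⟶ Z)
    (x : X.Idx) (x' : X'.Idx) (k : I) (w : Z.Idx) :
    entry (tensorMap f g ≫ h) (pair x x' k) w =
      ∑ y, ∑ y', entry f x y * entry g x' y' * entry h (pair y y' k) w :=
  sum_entry_tensorMap f g (isSupported_entry h w) x x' k

theorem comp_tensorMap_id {X Y X' Z : S.Obj} (f : X ⟶ Y) (h : Y.tensor X' ⟶ Z)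
    (x : X.Idx) (x' : X'.Idx) (k : I) (w : Z.Idx) :
    entry (tensorMap f (𝟙 X') ≫ h) (pair x x' k) w =
      ∑ y, entry f x y * entry h (pair y x' k) w := by
  rw [comp_tensorMap]
  refine Finset.sum_congr rfl fun y _ => ?_
  simp only [mul_assoc, ← Finset.mul_sum]
  rw [sum_entry_id ((isSupported_entry h w).pair_right y k)]

theorem comp_id_tensorMap {X X' Y' Z : S.Obj} (g : X' ⟶ Y') (h : X.tensor Y' ⟶ Z)
    (x : X.Idx) (x' : X'.Idx) (k : I) (w : Z.Idx) :
    entry (tensorMap (𝟙 X) g ≫ h) (pair x x' k) w =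
      ∑ y', entry g x' y' * entry h (pair x y' k) w := by
  rw [comp_tensorMap, Finset.sum_comm]
  refine Finset.sum_congr rfl fun y' _ => ?_
  rw [← sum_entry_id (((isSupported_entry h w).pair_left y' k).const_mul (entry g x' y')) x]
  exact Finset.sum_congr rfl fun y _ => mul_assoc _ _ _

theorem comp_assocHom {X Y Z W : S.Obj} (h : X.tensor (Y.tensor Z) ⟶ W)
    (x : X.Idx) (y : Y.Idx) (m : I) (z : Z.Idx) (k : I) (w : W.Idx) :
    entry (assocHom X Y Z ≫ h) (pair (pair x y m) z k) w =
      ∑ n, S.V (X.color x) (Y.color y) m (Z.color z) k n * entry h (pair x (pair y z n) k) w :=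
  sum_entry_assocHom (isSupported_entry h w) x y m z k

theorem comp_assocInv {X Y Z W : S.Obj} (h : (X.tensor Y).tensor Z ⟶ W)
    (x : X.Idx) (y : Y.Idx) (z : Z.Idx) (n k : I) (w : W.Idx) :
    entry (assocInv X Y Z ≫ h) (pair x (pair y z n) k) w =
      ∑ m, S.U (X.color x) (Y.color y) m (Z.color z) k n * entry h (pair (pair x y m) z k) w :=
  sum_entry_assocInv (isSupported_entry h w) x y z n k

theorem comp_leftHom {X Z : S.Obj} (h : X ⟶ Z) (u : (simple S R.one).Idx) (x : X.Idx) (k : I)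
    (w : Z.Idx) :
    entry (leftHom X ≫ h) (pair u x k) w = if k = X.color x then entry h x w else 0 :=
  sum_entry_leftHom (isSupported_entry h w) u x k

theorem comp_rightHom {X Z : S.Obj} (h : X ⟶ Z) (u : (simple S R.one).Idx) (x : X.Idx) (k : I)
    (w : Z.Idx) :
    entry (rightHom X ≫ h) (pair x u k) w = if k = X.color x then entry h x w else 0 :=
  sum_entry_rightHom (isSupported_entry h w) u x k

theorem comp_leftInv {X Z : S.Obj} (h : (simple S R.one).tensor X ⟶ Z) (x : X.Idx)
    (w : Z.Idx) :
    entry (leftInv X ≫ h) x w = entry h (pair (point S R.one) x (X.color x)) w :=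
  sum_entry_leftInv (isSupported_entry h w) x

theorem comp_rightInv {X Z : S.Obj} (h : X.tensor (simple S R.one) ⟶ Z) (x : X.Idx)
    (w : Z.Idx) :
    entry (rightInv X ≫ h) x w = entry h (pair x (point S R.one) (X.color x)) w :=
  sum_entry_rightInv (isSupported_entry h w) x

theorem assocHom_assocInv (X Y Z : S.Obj) : assocHom X Y Z ≫ assocInv X Y Z = 𝟙 _ := by
  classical
  refine hom_ext fun p q => ?_
  obtain ⟨p, z, k, rfl⟩ := exists_pair p
  obtain ⟨x, y, m, rfl⟩ := exists_pair p
  obtain ⟨q, z', k', rfl⟩ := exists_pair q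
  obtain ⟨x', y', m', rfl⟩ := exists_pair q
  rw [comp_assocHom]
  have h := S.U_mul_V (X.color x) (Y.color y) m' m (Z.color z) k
  simp only [entry_assocInv, entry_id, pair_inj, supp_pair, color_pair, mul_comm (S.V _ _ _ _ _ _),
    ite_mul, zero_mul]
  rw [Finset.sum_ite_irrel, Finset.sum_const_zero]
  rw [h]
  grind

theorem assocInv_assocHom (X Y Z : S.Obj) : assocInv X Y Z ≫ assocHom X Y Z = 𝟙 _ := by
  classical
  refine hom_ext fun p q => ?_
  obtain ⟨x, p, k, rfl⟩ := exists_pair p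
  obtain ⟨y, z, n, rfl⟩ := exists_pair p
  obtain ⟨x', q, k', rfl⟩ := exists_pair q
  obtain ⟨y', z', n', rfl⟩ := exists_pair q
  rw [comp_assocInv]
  have h := S.V_mul_U (X.color x) (Y.color y) (Z.color z) k n n'
  simp only [entry_assocHom, entry_id, pair_inj, supp_pair, mul_ite, mul_zero, color_pair]
  rw [Finset.sum_ite_irrel, Finset.sum_const_zero, h]
  grind

theorem leftHom_leftInv (X : S.Obj) : leftHom X ≫ leftInv X = 𝟙 _ := by
  classical
  refine hom_ext fun p q => ?_
  obtain ⟨u, x, k, rfl⟩ := exists_pair p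
  obtain ⟨u', x', k', rfl⟩ := exists_pair q
  rw [comp_leftHom, entry_leftInv]
  obtain rfl : u = point S R.one := rfl
  obtain rfl : u' = point S R.one := rfl
  simp only [entry_id, pair_inj, supp_pair, supp_point, color_point, R.N_one_left_ne]
  grind

theorem leftInv_leftHom (X : S.Obj) : leftInv X ≫ leftHom X = 𝟙 _ := by
  refine hom_ext fun x x' => ?_
  rw [comp_leftInv, entry_leftHom, if_pos rfl]

theorem rightHom_rightInv (X : S.Obj) : rightHom X ≫ rightInv X = 𝟙 _ := by
  classical
  refine hom_ext fun p q => ?_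
  obtain ⟨x, u, k, rfl⟩ := exists_pair p
  obtain ⟨x', u', k', rfl⟩ := exists_pair q
  rw [comp_rightHom, entry_rightInv]
  obtain rfl : u = point S R.one := rfl
  obtain rfl : u' = point S R.one := rfl
  simp only [entry_id, pair_inj, supp_pair, supp_point, color_point, R.N_one_right_ne]
  grind

theorem rightInv_rightHom (X : S.Obj) : rightInv X ≫ rightHom X = 𝟙 _ := by
  refine hom_ext fun x x' => ?_
  rw [comp_rightInv, entry_rightHom, if_pos rfl]

theorem leftHom_naturality {X Y : S.Obj} (f : X ⟶ Y) :
    tensorMap (𝟙 (simple S R.one)) f ≫ leftHom Y = leftHom X ≫ f := by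
  refine hom_ext fun p w => ?_
  obtain ⟨u, x, k, rfl⟩ := exists_pair p
  rw [comp_id_tensorMap, comp_leftHom]
  simp only [entry_leftHom]
  have h : ∀ y, (entry f x y * if k = Y.color y then entry (𝟙 Y) y w else 0) =
      if k = X.color x then entry f x y * entry (𝟙 Y) y w else 0 := by
    intro y
    by_cases hf : entry f x y = 0
    · simp [hf]
    · rw [color_eq hf]; split_ifs <;> simp
  simp only [h, Finset.sum_ite_irrel, Finset.sum_const_zero]
  rw [← entry_comp, Category.comp_id]

theorem rightHom_naturality {X Y : S.Obj} (f : X ⟶ Y) :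
    tensorMap f (𝟙 (simple S R.one)) ≫ rightHom Y = rightHom X ≫ f := by
  refine hom_ext fun p w => ?_
  obtain ⟨x, u, k, rfl⟩ := exists_pair p
  rw [comp_tensorMap_id, comp_rightHom]
  simp only [entry_rightHom]
  have h : ∀ y, (entry f x y * if k = Y.color y then entry (𝟙 Y) y w else 0) =
      if k = X.color x then entry f x y * entry (𝟙 Y) y w else 0 := by
    intro y
    by_cases hf : entry f x y = 0
    · simp [hf]
    · rw [color_eq hf]; split_ifs <;> simp
  simp only [h, Finset.sum_ite_irrel, Finset.sum_const_zero]
  rw [← entry_comp, Category.comp_id]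

theorem assocHom_naturality {X Y Z X' Y' Z' : S.Obj} (f : X ⟶ X') (g : Y ⟶ Y') (h : Z ⟶ Z') :
    tensorMap (tensorMap f g) h ≫ assocHom X' Y' Z' =
      assocHom X Y Z ≫ tensorMap f (tensorMap g h) := by
  rw [← Category.comp_id (assocHom X' Y' Z'), ← Category.comp_id (tensorMap f (tensorMap g h))]
  refine hom_ext fun p w => ?_
  obtain ⟨p, z, k, rfl⟩ := exists_pair p
  obtain ⟨x, y, m, rfl⟩ := exists_pair p
  have hs := isSupported_entry (𝟙 (X'.tensor (Y'.tensor Z'))) w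
  rw [comp_tensorMap, comp_assocHom, Finset.sum_comm]
  simp only [comp_tensorMap]
  have hL : ∀ z' : Z'.Idx, ∑ q, entry (tensorMap f g) (pair x y m) q * entry h z z' *
      entry (assocHom X' Y' Z' ≫ 𝟙 _) (pair q z' k) w = ∑ x', ∑ y', entry f x x' * entry g y y' *
        (entry h z z' * ∑ n, S.V (X.color x) (Y.color y) m (Z.color z) k n *
          entry (𝟙 (X'.tensor (Y'.tensor Z'))) (pair x' (pair y' z' n) k) w) := by
    intro z'
    simp only [mul_assoc]
    rw [sum_entry_tensorMap f g
      (((isSupported_entry (assocHom X' Y' Z' ≫ 𝟙 _) w).pair_left z' k).const_mul _)]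
    refine Finset.sum_congr rfl fun x' _ => Finset.sum_congr rfl fun y' _ => ?_
    rw [comp_assocHom]
    by_cases hf : entry f x x' = 0
    · simp [hf]
    by_cases hg : entry g y y' = 0
    · simp [hg]
    by_cases hh : entry h z z' = 0
    · simp [hh]
    rw [color_eq hf, color_eq hg, color_eq hh, mul_assoc]
  have hR : ∀ n x', ∑ q, entry f x x' * entry (tensorMap g h) (pair y z n) q *
      entry (𝟙 (X'.tensor (Y'.tensor Z'))) (pair x' q k) w = entry f x x' * ∑ y', ∑ z',
        entry g y y' * entry h z z' *
          entry (𝟙 (X'.tensor (Y'.tensor Z'))) (pair x' (pair y' z' n) k) w := by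
    intro n x'
    rw [← sum_entry_tensorMap g h (hs.pair_right x' k)]
    simp only [mul_assoc, Finset.mul_sum]
  simp only [hL, hR, Finset.mul_sum]
  -- both sides are sums over `x'`, `y'`, `z'` and `n`
  rw [Finset.sum_comm]
  rw [Finset.sum_comm (s := Finset.univ (α := I))]
  refine Finset.sum_congr rfl fun x' _ => ?_
  rw [Finset.sum_comm, Finset.sum_comm (s := Finset.univ (α := I))]
  refine Finset.sum_congr rfl fun y' _ => ?_
  rw [Finset.sum_comm (s := Finset.univ (α := I))]
  refine Finset.sum_congr rfl fun z' _ => Finset.sum_congr rfl fun n _ => ?_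
  ring

/-- The pentagon of the inverse associators is the pentagon equation of the symbols. -/
theorem assocInv_pentagon (W X Y Z : S.Obj) :
    tensorMap (𝟙 W) (assocInv X Y Z) ≫ assocInv W (X.tensor Y) Z ≫
      tensorMap (assocInv W X Y) (𝟙 Z) =
    assocInv W X (Y.tensor Z) ≫ assocInv (W.tensor X) Y Z := by
  rw [← Category.comp_id (assocInv (W.tensor X) Y Z), ← Category.comp_id (tensorMap _ (𝟙 Z))]
  refine hom_ext fun p v => ?_
  obtain ⟨w, p, k, rfl⟩ := exists_pair p
  obtain ⟨x, p, s, rfl⟩ := exists_pair p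
  obtain ⟨y, z, n, rfl⟩ := exists_pair p
  rw [comp_id_tensorMap, comp_assocInv]
  rw [sum_entry_assocInv ((isSupported_entry _ v).pair_right w k)]
  simp only [comp_assocInv, comp_tensorMap_id, color_pair]
  have h : ∀ m r, ∑ q, entry (assocInv W X Y) (pair w (pair x y m) r) q *
      entry (𝟙 _) (pair q z k) v = ∑ t, S.U (W.color w) (X.color x) t (Y.color y) r m *
        entry (𝟙 _) (pair (pair (pair w x t) y r) z k) v := fun m r =>
    sum_entry_assocInv ((isSupported_entry _ v).pair_left z k) w x y m r
  simp only [h, Finset.mul_sum, ← mul_assoc]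
  have h2 : ∀ r t, ∑ m, S.U (X.color x) (Y.color y) m (Z.color z) s n *
      S.U (W.color w) m r (Z.color z) k s * S.U (W.color w) (X.color x) t (Y.color y) r m *
        entry (𝟙 (((W.tensor X).tensor Y).tensor Z)) (pair (pair (pair w x t) y r) z k) v =
      S.U (W.color w) (X.color x) t n k s * S.U t (Y.color y) r (Z.color z) k n *
        entry (𝟙 (((W.tensor X).tensor Y).tensor Z)) (pair (pair (pair w x t) y r) z k) v := by
    intro r t
    rw [← Finset.sum_mul, mul_comm (S.U (W.color w) (X.color x) t n k s), S.pentagon]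
    exact congrArg (· * _) (Finset.sum_congr rfl fun m _ => by ring)
  exact (Finset.sum_comm.trans (Finset.sum_congr rfl fun r _ => Finset.sum_comm.trans
    (Finset.sum_congr rfl fun t _ => h2 r t))).trans Finset.sum_comm

/-- The triangle axiom holds because the symbols `V` with trivial second label are `1`. -/
theorem assoc_triangle (X Y : S.Obj) :
    assocHom X (simple S R.one) Y ≫ tensorMap (𝟙 X) (leftHom Y) = tensorMap (rightHom X) (𝟙 Y) := by
  rw [← Category.comp_id (tensorMap (𝟙 X) (leftHom Y)),
    ← Category.comp_id (tensorMap (rightHom X) (𝟙 Y))]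
  refine hom_ext fun p v => ?_
  obtain ⟨p, y, k, rfl⟩ := exists_pair p
  obtain ⟨x, u, m, rfl⟩ := exists_pair p
  obtain rfl : u = point S R.one := rfl
  rw [comp_assocHom, comp_tensorMap_id,
    sum_entry_rightHom ((isSupported_entry _ v).pair_left y k)]
  simp only [comp_id_tensorMap]
  have h : ∀ n, ∑ q, entry (leftHom Y) (pair (point S R.one) y n) q * entry (𝟙 _) (pair x q k) v =
      if n = Y.color y then entry (𝟙 _) (pair x y k) v else 0 := fun n =>
    sum_entry_leftHom ((isSupported_entry _ v).pair_right x k) _ y n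
  simp only [h, mul_ite, mul_zero, Finset.sum_ite_eq', Finset.mem_univ, if_true, color_point]
  by_cases hN : R.N (X.color x) (Y.color y) k ≠ 0
  · split_ifs with hm
    · rw [hm, S.V_triangle _ _ _ hN, _root_.one_mul]
    · rw [S.V_zero, zero_mul]
      exact fun ha => hm (R.N_one_right_ne.mp ha.1).symm
  · have h0 : entry (𝟙 (X.tensor Y)) (pair x y k) v = 0 :=
      entry_eq_zero _ fun h1 => hN h1.1.2.2
    simp [h0]

/-- The tensor structure of the category of a system of spherical symbols. -/
noncomputable instance : MonoidalCategoryStruct S.Obj where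
  tensorObj X Y := X.tensor Y
  tensorHom f g := tensorMap f g
  whiskerLeft X _ _ f := tensorMap (𝟙 X) f
  whiskerRight f Y := tensorMap f (𝟙 Y)
  tensorUnit := simple S R.one
  associator X Y Z := ⟨assocHom X Y Z, assocInv X Y Z, assocHom_assocInv X Y Z,
    assocInv_assocHom X Y Z⟩
  leftUnitor X := ⟨leftHom X, leftInv X, leftHom_leftInv X, leftInv_leftHom X⟩
  rightUnitor X := ⟨rightHom X, rightInv X, rightHom_rightInv X, rightInv_rightHom X⟩

/-- The inverse of the pentagon of the inverse associators. -/
theorem assocHom_pentagon (W X Y Z : S.Obj) :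
    tensorMap (assocHom W X Y) (𝟙 Z) ≫ assocHom W (X.tensor Y) Z ≫
      tensorMap (𝟙 W) (assocHom X Y Z) =
    assocHom (W.tensor X) Y Z ≫ assocHom W X (Y.tensor Z) := by
  have h1 : (tensorMap (assocHom W X Y) (𝟙 Z) ≫ assocHom W (X.tensor Y) Z ≫
      tensorMap (𝟙 W) (assocHom X Y Z)) ≫ (tensorMap (𝟙 W) (assocInv X Y Z) ≫
      assocInv W (X.tensor Y) Z ≫ tensorMap (assocInv W X Y) (𝟙 Z)) = 𝟙 _ := by
    have e1 : tensorMap (𝟙 W) (assocHom X Y Z) ≫ tensorMap (𝟙 W) (assocInv X Y Z) = 𝟙 _ := by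
      rw [tensorMap_comp, assocHom_assocInv, Category.comp_id, tensorMap_id]
    have e2 : tensorMap (assocHom W X Y) (𝟙 Z) ≫ tensorMap (assocInv W X Y) (𝟙 Z) = 𝟙 _ := by
      rw [tensorMap_comp, assocHom_assocInv, Category.comp_id, tensorMap_id]
    simp only [Category.assoc, reassoc_of% e1, reassoc_of% (assocHom_assocInv W (X.tensor Y) Z), e2]
  rw [assocInv_pentagon] at h1
  have h2 : (assocInv W X (Y.tensor Z) ≫ assocInv (W.tensor X) Y Z) ≫
      (assocHom (W.tensor X) Y Z ≫ assocHom W X (Y.tensor Z)) = 𝟙 _ := by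
    simp only [Category.assoc, reassoc_of% (assocInv_assocHom (W.tensor X) Y Z),
      assocInv_assocHom]
  rw [← Category.comp_id (tensorMap (assocHom W X Y) (𝟙 Z) ≫ _), ← h2, ← Category.assoc, h1,
    Category.id_comp]

noncomputable instance : MonoidalCategory S.Obj := MonoidalCategory.ofTensorHom
  (id_tensorHom_id := tensorMap_id)
  (id_tensorHom := fun _ _ _ _ => rfl)
  (tensorHom_id := fun _ _ => rfl)
  (tensorHom_comp_tensorHom := tensorMap_comp)
  (associator_naturality := assocHom_naturality)
  (leftUnitor_naturality := leftHom_naturality)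
  (rightUnitor_naturality := rightHom_naturality)
  (pentagon := assocHom_pentagon)
  (triangle := assoc_triangle)

end Coherence

end FusionRing.SphericalSymbols.Obj

/-! ### Duality -/

namespace FusionRing.SphericalSymbols

variable {I : Type u} [Fintype I] [DecidableEq I] {R : FusionRing I} {S : R.SphericalSymbols}

/-- The square root of the dimension of a label, the normalization of the duality pairings. -/
noncomputable def sqrtDim (S : R.SphericalSymbols) (i : I) : ℂ := ((√(S.d i) : ℝ) : ℂ)

theorem sqrtDim_ne_zero (i : I) : S.sqrtDim i ≠ 0 := by
  unfold sqrtDim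
  exact_mod_cast (Real.sqrt_pos.mpr (S.d_pos i)).ne'

theorem sqrtDim_mul_self (i : I) : S.sqrtDim i * S.sqrtDim i = (S.d i : ℂ) := by
  unfold sqrtDim
  exact_mod_cast Real.mul_self_sqrt (S.d_pos i).le

theorem sqrtDim_dual (i : I) : S.sqrtDim (R.dual i) = S.sqrtDim i := by
  rw [sqrtDim, S.d_dual, sqrtDim]

theorem sqrtDim_one : S.sqrtDim R.one = 1 := by
  rw [sqrtDim, S.d_one]; simp

theorem U_nested_eq {i j k : I} (h : R.N i j k ≠ 0) :
    S.U (R.dual i) i R.one j j k = S.sqrtDim k / (S.sqrtDim i * S.sqrtDim j) := by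
  rw [S.U_nested i j k h]
  simp [sqrtDim]

namespace Obj

/-- The dual object: the same summands with dual labels. -/
def dual (X : S.Obj) : S.Obj := ⟨X.code, fun x => R.dual (X.color x), X.supp⟩

/-- The summands of the dual correspond to those of the object. -/
def toDual {X : S.Obj} (x : X.Idx) : X.dual.Idx := x

theorem toDual_induction {X : S.Obj} {P : X.dual.Idx → Prop} (h : ∀ x : X.Idx, P (toDual x))
    (y : X.dual.Idx) : P y := h y

theorem sum_toDual {X : S.Obj} {M : Type*} [AddCommMonoid M] (g : X.dual.Idx → M) :
    ∑ y, g y = ∑ x : X.Idx, g (toDual x) := rfl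

theorem color_toDual {X : S.Obj} (x : X.Idx) : X.dual.color (toDual x) = R.dual (X.color x) := rfl

theorem IsSupported.comp_toDual {X : S.Obj} {g : X.dual.Idx → ℂ} (hg : X.dual.IsSupported g) :
    X.IsSupported fun x => g (toDual x) := fun x hx => hg (toDual x) hx

/-- The coevaluation: on a simple summand `i` it is `√(d i)` times the inclusion of the unit. -/
noncomputable def coev (X : S.Obj) : simple S R.one ⟶ X.tensor X.dual :=
  homMk (fun _ p => if p.2.2 = R.one then S.sqrtDim (X.color p.1) * entry (𝟙 X) p.1 p.2.1 else 0)
  (by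
  rintro ⟨⟩ ⟨x, x', k⟩ h
  by_contra h0
  simp only [ite_eq_right_iff, mul_eq_zero, not_forall, not_or] at h0
  obtain ⟨rfl, -, h0⟩ := h0
  have h1 : X.supp x ∧ X.supp x' ∧ X.color x = X.color x' := by
    by_contra h1; exact h0 (entry_eq_zero _ h1)
  refine h ⟨trivial, ⟨h1.1, h1.2.1, ?_⟩, rfl⟩
  rw [R.N_one_out_ne]
  exact congrArg R.dual h1.2.2.symm)

/-- The evaluation: on a simple summand `i` it is `√(d i)` times the projection to the unit. -/
noncomputable def ev (X : S.Obj) : X.dual.tensor X ⟶ simple S R.one :=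
  homMk (fun p _ => if p.2.2 = R.one then S.sqrtDim (X.color p.1) * entry (𝟙 X) p.1 p.2.1 else 0)
  (by
  rintro ⟨x, x', k⟩ ⟨⟩ h
  by_contra h0
  simp only [ite_eq_right_iff, mul_eq_zero, not_forall, not_or] at h0
  obtain ⟨rfl, -, h0⟩ := h0
  have h1 : X.supp x ∧ X.supp x' ∧ X.color x = X.color x' := by
    by_contra h1; exact h0 (entry_eq_zero _ h1)
  refine h ⟨⟨h1.1, h1.2.1, ?_⟩, trivial, rfl⟩
  rw [R.N_one_out_ne, ← h1.2.2]
  exact (R.dual_dual _).symm)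

theorem entry_coev {X : S.Obj} (u : (simple S R.one).Idx) (x x' : X.Idx) (k : I) :
    entry (coev X) u (pair x (toDual x') k) =
      if k = R.one then S.sqrtDim (X.color x) * entry (𝟙 X) x x' else 0 := rfl

theorem entry_ev {X : S.Obj} (u : (simple S R.one).Idx) (x x' : X.Idx) (k : I) :
    entry (ev X) (pair (toDual x) x' k) u =
      if k = R.one then S.sqrtDim (X.color x) * entry (𝟙 X) x x' else 0 := rfl

theorem sum_entry_coev {X : S.Obj} {h : (X.tensor X.dual).Idx → ℂ}
    (hh : (X.tensor X.dual).IsSupported h) (u : (simple S R.one).Idx) :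
    ∑ q, entry (coev X) u q * h q =
      ∑ x : X.Idx, S.sqrtDim (X.color x) * h (pair x (toDual x) R.one) := by
  rw [sum_pair]
  refine Finset.sum_congr rfl fun x _ => ?_
  rw [sum_toDual]
  simp only [entry_coev, ite_mul, zero_mul, Finset.sum_ite_eq', Finset.mem_univ, if_true]
  rw [← sum_entry_id (((hh.pair_right x R.one).comp_toDual).const_mul (S.sqrtDim (X.color x))) x]
  exact Finset.sum_congr rfl fun x' _ => by ring

theorem comp_coev {X Z : S.Obj} (h : X.tensor X.dual ⟶ Z) (u : (simple S R.one).Idx) (w : Z.Idx) :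
    entry (coev X ≫ h) u w =
      ∑ x : X.Idx, S.sqrtDim (X.color x) * entry h (pair x (toDual x) R.one) w :=
  sum_entry_coev (isSupported_entry h w) u

/-- Only the recoupling with both intermediate labels trivial contributes to the zigzag, with the
coefficient `d i * U i* i 1 i* i* 1 = 1`. -/
theorem coev_ev (X : S.Obj) :
    tensorMap (𝟙 X.dual) (coev X) ≫ assocInv X.dual X X.dual ≫ tensorMap (ev X) (𝟙 X.dual) =
      rightHom X.dual ≫ leftInv X.dual := by
  rw [← Category.comp_id (tensorMap (ev X) (𝟙 X.dual)), ← Category.comp_id (leftInv X.dual)]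
  refine hom_ext fun p w => ?_
  obtain ⟨y, u, k, rfl⟩ := exists_pair p
  induction y using toDual_induction with | h y
  rw [comp_id_tensorMap, sum_entry_coev ((isSupported_entry _ w).pair_right _ k), comp_rightHom,
    comp_leftInv]
  have h1 : ∀ x : X.Idx, S.sqrtDim (X.color x) *
      entry (assocInv X.dual X X.dual ≫ tensorMap (ev X) (𝟙 X.dual) ≫ 𝟙 _)
        (pair (toDual y) (pair x (toDual x) R.one) k) w =
      entry (𝟙 X) y x * ((S.sqrtDim (X.color y) * S.sqrtDim (X.color y) *
        S.U (R.dual (X.color y)) (X.color y) R.one (R.dual (X.color y)) k R.one) *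
        entry (𝟙 ((simple S R.one).tensor X.dual)) (pair (point S R.one) (toDual x) k) w) := by
    intro x
    rw [comp_assocInv]
    simp only [comp_tensorMap_id, sum_point]
    rw [Finset.sum_eq_single R.one]
    · rw [entry_ev, if_pos rfl]
      by_cases h0 : entry (𝟙 X) y x = 0
      · simp [h0]
      · rw [color_toDual, color_toDual, color_eq h0]; ring
    · intro m _ hm
      simp only [entry_ev, if_neg hm, zero_mul, mul_zero]
    · simp
  simp only [h1]
  rw [sum_entry_id ((((isSupported_entry _ w).pair_right _ k).comp_toDual).const_mul _),
    color_toDual]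
  split_ifs with hk
  · rw [hk, U_nested_eq (by rw [R.N_one_out_ne]), sqrtDim_one, sqrtDim_dual]
    have := S.sqrtDim_ne_zero (X.color y)
    field_simp
  · rw [S.U_zero, mul_zero, zero_mul]
    exact fun ha => hk (R.N_one_left_ne.mp ha.2.1).symm

/-- The other zigzag contributes `d i * V i i* 1 i i 1 = 1`. -/
theorem ev_coev (X : S.Obj) :
    tensorMap (coev X) (𝟙 X) ≫ assocHom X X.dual X ≫ tensorMap (𝟙 X) (ev X) =
      leftHom X ≫ rightInv X := by
  rw [← Category.comp_id (tensorMap (𝟙 X) (ev X)), ← Category.comp_id (rightInv X)]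
  refine hom_ext fun p w => ?_
  obtain ⟨u, y, k, rfl⟩ := exists_pair p
  rw [comp_tensorMap_id, sum_entry_coev ((isSupported_entry _ w).pair_left _ k), comp_leftHom,
    comp_rightInv]
  have h1 : ∀ x : X.Idx, S.sqrtDim (X.color x) *
      entry (assocHom X X.dual X ≫ tensorMap (𝟙 X) (ev X) ≫ 𝟙 _)
        (pair (pair x (toDual x) R.one) y k) w =
      entry (𝟙 X) x y * ((S.sqrtDim (X.color y) * S.sqrtDim (X.color y) *
        S.V (X.color y) (R.dual (X.color y)) R.one (X.color y) k R.one) *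
        entry (𝟙 (X.tensor (simple S R.one))) (pair x (point S R.one) k) w) := by
    intro x
    rw [comp_assocHom]
    simp only [comp_id_tensorMap, sum_point]
    rw [Finset.sum_eq_single R.one]
    · rw [entry_ev, if_pos rfl]
      by_cases h0 : entry (𝟙 X) x y = 0
      · simp [h0]
      · rw [color_toDual, color_eq h0]; ring
    · intro m _ hm
      simp only [entry_ev, if_neg hm, zero_mul, mul_zero]
    · simp
  simp only [h1]
  rw [sum_mul_entry_id (((isSupported_entry _ w).pair_left _ k).const_mul _)]
  split_ifs with hk
  · rw [hk, S.V_snake, sqrtDim_mul_self, mul_inv_cancel₀, _root_.one_mul]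
    exact_mod_cast (S.d_pos _).ne'
  · rw [S.V_zero, mul_zero, zero_mul]
    exact fun ha => hk (R.N_one_left_ne.mp ha.2.1).symm

noncomputable instance exactPairing (X : S.Obj) : ExactPairing X X.dual where
  coevaluation' := coev X
  evaluation' := ev X
  coevaluation_evaluation' := coev_ev X
  evaluation_coevaluation' := ev_coev X

/-- The canonical isomorphism from an object to its double dual is the identity matrix. -/
noncomputable def doubleDual (X : S.Obj) : X ≅ X.dual.dual where
  hom := homMk (fun x y => entry (𝟙 X) x y) fun _ _ h => entry_eq_zero _ fun h1 =>
    h ⟨h1.1, h1.2.1, h1.2.2.trans (R.dual_dual _).symm⟩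
  inv := homMk (fun x y => entry (𝟙 X) x y) fun _ _ h => entry_eq_zero _ fun h1 =>
    h ⟨h1.1, h1.2.1, (R.dual_dual _).trans h1.2.2⟩
  hom_inv_id := hom_ext fun x y => congrFun (congrFun (congrArg entry (Category.id_comp (𝟙 X))) x) y
  inv_hom_id := hom_ext fun x y => congrFun (congrFun (congrArg entry (Category.id_comp (𝟙 X))) x) y

theorem entry_doubleDual_hom {X : S.Obj} (x y : X.Idx) :
    entry (doubleDual X).hom x (toDual (toDual y)) = entry (𝟙 X) x y := rfl

/-- The left dual is the right dual, by way of the double dual. -/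
noncomputable instance : RigidCategory S.Obj where
  rightDual X := ⟨X.dual⟩
  leftDual X :=
    { leftDual := X.dual
      exact := exactPairingCongrRight (Y' := X.dual.dual) (doubleDual X) }

end Obj

end FusionRing.SphericalSymbols

/-! ### The pivotal structure -/

namespace CategoryTheory

variable {C : Type u} [Category.{v} C] [MonoidalCategory C]

/-- The right mate is determined by its compatibility with the evaluations. -/
theorem eq_rightAdjointMate {X Y : C} [HasRightDual X] [HasRightDual Y] (f : X ⟶ Y)
    (g : Yᘁ ⟶ Xᘁ) (h : g ▷ X ≫ ε_ X (Xᘁ) = (Yᘁ) ◁ f ≫ ε_ Y (Yᘁ)) : g = fᘁ := by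
  have h1 := congrArg (tensorRightHomEquiv _ X (Xᘁ) _) h
  rw [tensorRightHomEquiv_whiskerRight_comp_evaluation,
    tensorRightHomEquiv_whiskerLeft_comp_evaluation] at h1
  exact (cancel_mono _).mp h1

/-- The canonical isomorphism `(X ⊗ Y)* ≅ Y* ⊗ X*` is determined by the nested evaluation. -/
theorem eq_rightDualTensorIso_hom {X Y : C} [HasRightDual X] [HasRightDual Y]
    [HasRightDual (X ⊗ Y)] (t : (X ⊗ Y)ᘁ ⟶ Yᘁ ⊗ Xᘁ)
    (h : t ▷ (X ⊗ Y) ≫ (α_ _ _ _).hom ≫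
      (Yᘁ) ◁ ((α_ _ _ _).inv ≫ ε_ X (Xᘁ) ▷ Y ≫ (λ_ Y).hom) ≫ ε_ Y (Yᘁ) =
        ε_ (X ⊗ Y) ((X ⊗ Y)ᘁ)) :
    (rightDualTensorIso X Y).hom = t := by
  refine (@eq_rightAdjointMate C _ _ (X ⊗ Y) (X ⊗ Y) ⟨Yᘁ ⊗ Xᘁ⟩ _ (𝟙 (X ⊗ Y)) t ?_).symm
  rw [MonoidalCategory.whiskerLeft_id, Category.id_comp, ← h]
  congr 1
  change ε_ (X ⊗ Y) (Yᘁ ⊗ Xᘁ) = _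
  rw [ExactPairing.tensor_evaluation]
  monoidal

end CategoryTheory

namespace FusionRing.SphericalSymbols.Obj

variable {I : Type u} [Fintype I] [DecidableEq I] {R : FusionRing I} {S : R.SphericalSymbols}

/-- The transposed matrix, a morphism of the dual objects. -/
def transpose {X Y : S.Obj} (f : X ⟶ Y) : Y.dual ⟶ X.dual :=
  homMk (fun y x => entry f x y) fun _ _ h => entry_eq_zero _ fun h1 =>
    h ⟨h1.2.1, h1.1, congrArg R.dual h1.2.2.symm⟩

theorem entry_transpose {X Y : S.Obj} (f : X ⟶ Y) (x : X.Idx) (y : Y.Idx) :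
    entry (transpose f) (toDual y) (toDual x) = entry f x y := rfl

theorem comp_ev {X Y : S.Obj} (f : Y ⟶ X) (x : X.Idx) (y : Y.Idx) (k : I)
    (u : (simple S R.one).Idx) :
    ∑ x' : X.Idx, entry f y x' * entry (ev X) (pair (toDual x) x' k) u =
      if k = R.one then S.sqrtDim (X.color x) * entry f y x else 0 := by
  simp only [entry_ev, mul_ite, mul_zero, Finset.sum_ite_irrel, Finset.sum_const_zero,
    mul_left_comm (entry f _ _), ← Finset.mul_sum]
  congr 2
  simp only [entry_id_comm x]
  exact congrFun (congrFun (congrArg entry (Category.comp_id f)) y) x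

/-- The mate of a morphism is its transpose. -/
theorem rightAdjointMate_eq {X Y : S.Obj} (f : X ⟶ Y) : fᘁ = transpose f := by
  refine (eq_rightAdjointMate f (transpose f) ?_).symm
  change tensorMap (transpose f) (𝟙 X) ≫ ev X = tensorMap (𝟙 Y.dual) f ≫ ev Y
  refine hom_ext fun p u => ?_
  obtain ⟨y, x, k, rfl⟩ := exists_pair p
  induction y using toDual_induction with | h y
  rw [comp_tensorMap_id, comp_id_tensorMap, comp_ev, sum_toDual]
  simp only [entry_transpose, entry_ev, mul_ite, mul_zero, Finset.sum_ite_irrel,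
    Finset.sum_const_zero]
  congr 1
  have h1 : ∀ x', entry f x' y * (S.sqrtDim (X.color x') * entry (𝟙 X) x' x) =
      S.sqrtDim (Y.color y) * (entry (𝟙 X) x x' * entry f x' y) := by
    intro x'
    rw [entry_id_comm x' x]
    by_cases h0 : entry f x' y = 0
    · simp [h0]
    · rw [color_eq h0]; ring
  simp only [h1, ← Finset.mul_sum]
  rw [← entry_comp, Category.id_comp]

theorem N_dual_pair {X Y : S.Obj} {x : X.Idx} {y : Y.Idx} {k : I} :
    R.N (Y.dual.color (toDual y)) (X.dual.color (toDual x)) k ≠ 0 ↔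
      R.N (X.color x) (Y.color y) (R.dual k) ≠ 0 := by
  rw [color_toDual, color_toDual, ← R.dual_mul (X.color x), R.dual_dual]

/-- The canonical morphism from the dual of a tensor product to the tensor product of the duals,
a permutation matrix. -/
noncomputable def tensorDualHom (X Y : S.Obj) : (X.tensor Y).dual ⟶ Y.dual.tensor X.dual :=
  homMk (fun p q => if q.2.2 = R.dual p.2.2 then
    entry (𝟙 (X.tensor Y)) p (pair (X := X) (Y := Y) q.2.1 q.1 p.2.2) else 0) (by
  rintro ⟨x, y, k⟩ ⟨y', x', k'⟩ h
  by_contra h0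
  simp only [ite_eq_right_iff, not_forall] at h0
  obtain ⟨rfl, h0⟩ := h0
  have h1 : (X.tensor Y).supp (x, y, k) ∧ (X.tensor Y).supp (pair x' y' k) ∧ k = k := by
    by_contra h1; exact h0 (entry_eq_zero _ h1)
  refine h ⟨h1.1, ⟨h1.2.1.2.1, h1.2.1.1, ?_⟩, rfl⟩
  exact N_dual_pair.mpr ((R.dual_dual k).symm ▸ h1.2.1.2.2))

/-- The inverse of `tensorDualHom`. -/
noncomputable def tensorDualInv (X Y : S.Obj) : Y.dual.tensor X.dual ⟶ (X.tensor Y).dual :=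
  homMk (fun q p => if q.2.2 = R.dual p.2.2 then
    entry (𝟙 (X.tensor Y)) (pair (X := X) (Y := Y) q.2.1 q.1 p.2.2) p else 0) (by
  rintro ⟨y', x', k'⟩ ⟨x, y, k⟩ h
  by_contra h0
  simp only [ite_eq_right_iff, not_forall] at h0
  obtain ⟨rfl, h0⟩ := h0
  have h1 : (X.tensor Y).supp (pair x' y' k) ∧ (X.tensor Y).supp (x, y, k) ∧ k = k := by
    by_contra h1; exact h0 (entry_eq_zero _ h1)
  refine h ⟨⟨h1.1.2.1, h1.1.1, ?_⟩, h1.2.1, rfl⟩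
  exact N_dual_pair.mpr ((R.dual_dual k).symm ▸ h1.1.2.2))

theorem entry_tensorDualHom {X Y : S.Obj} (p : (X.tensor Y).Idx) (x : X.Idx) (y : Y.Idx) (k : I) :
    entry (tensorDualHom X Y) (toDual p) (pair (toDual y) (toDual x) k) =
      entry (𝟙 (X.tensor Y)) p (pair x y (R.dual k)) := by
  obtain ⟨x', y', k', rfl⟩ := exists_pair p
  change (if k = R.dual k' then entry (𝟙 (X.tensor Y)) (pair x' y' k') (pair x y k') else 0) = _
  split_ifs with h
  · rw [h, R.dual_dual]
  · refine (entry_eq_zero _ fun h1 => h ?_).symm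
    exact (R.dual_dual k).symm.trans (congrArg R.dual h1.2.2.symm)

theorem entry_tensorDualInv {X Y : S.Obj} (p : (X.tensor Y).Idx) (x : X.Idx) (y : Y.Idx) (k : I) :
    entry (tensorDualInv X Y) (pair (toDual y) (toDual x) k) (toDual p) =
      entry (𝟙 (X.tensor Y)) (pair x y (R.dual k)) p := by
  obtain ⟨x', y', k', rfl⟩ := exists_pair p
  change (if k = R.dual k' then entry (𝟙 (X.tensor Y)) (pair x y k') (pair x' y' k') else 0) = _
  split_ifs with h
  · rw [h, R.dual_dual]
  · refine (entry_eq_zero _ fun h1 => h ?_).symm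
    exact (R.dual_dual k).symm.trans (congrArg R.dual h1.2.2)

theorem comp_tensorDualInv {X Y Z : S.Obj} (h : (X.tensor Y).dual ⟶ Z) (x : X.Idx) (y : Y.Idx)
    (k : I) (w : Z.Idx) :
    entry (tensorDualInv X Y ≫ h) (pair (toDual y) (toDual x) k) w =
      entry h (toDual (pair x y (R.dual k))) w := by
  rw [entry_comp, sum_toDual]
  simp only [entry_tensorDualInv]
  exact sum_entry_id (isSupported_entry h w).comp_toDual _

theorem sum_entry_tensorDualHom {X Y : S.Obj} {h : (Y.dual.tensor X.dual).Idx → ℂ}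
    (hh : (Y.dual.tensor X.dual).IsSupported h) (x : X.Idx) (y : Y.Idx) (k : I) :
    ∑ q, entry (tensorDualHom X Y) (toDual (pair x y k)) q * h q =
      h (pair (toDual y) (toDual x) (R.dual k)) := by
  have hs : (X.tensor Y).IsSupported fun q =>
      h (pair (X := Y.dual) (Y := X.dual) (toDual q.2.1) (toDual q.1) (R.dual q.2.2)) :=
    fun q hq => hh _ fun h1 =>
      hq ⟨h1.2.1, h1.1, R.dual_dual q.2.2 ▸ (N_dual_pair (k := R.dual q.2.2)).mp h1.2.2⟩
  refine Eq.trans ?_ (sum_entry_id hs (pair x y k))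
  rw [sum_pair, sum_pair, sum_toDual, Finset.sum_comm, sum_toDual]
  refine Finset.sum_congr rfl fun x' _ => Finset.sum_congr rfl fun y' _ => ?_
  rw [← Equiv.sum_comp R.dualEquiv]
  refine Finset.sum_congr rfl fun k' _ => ?_
  change entry (tensorDualHom X Y) (toDual (pair x y k)) (pair (toDual y') (toDual x') (R.dual k'))
    * h (pair (toDual y') (toDual x') (R.dual k')) = _
  rw [entry_tensorDualHom, R.dual_dual]
  rfl

theorem comp_tensorDualHom {X Y Z : S.Obj} (h : Y.dual.tensor X.dual ⟶ Z) (x : X.Idx) (y : Y.Idx)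
    (k : I) (w : Z.Idx) :
    entry (tensorDualHom X Y ≫ h) (toDual (pair x y k)) w =
      entry h (pair (toDual y) (toDual x) (R.dual k)) w :=
  sum_entry_tensorDualHom (isSupported_entry h w) x y k

theorem tensorDualHom_inv (X Y : S.Obj) : tensorDualHom X Y ≫ tensorDualInv X Y = 𝟙 _ := by
  refine hom_ext fun p q => ?_
  induction p using toDual_induction with | h p
  induction q using toDual_induction with | h q
  obtain ⟨x, y, k, rfl⟩ := exists_pair p
  rw [comp_tensorDualHom, entry_tensorDualInv, R.dual_dual]
  rfl

theorem eq_tensorDualInv {X Y : S.Obj} {t : Y.dual.tensor X.dual ⟶ (X.tensor Y).dual}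
    (h : t ≫ tensorDualHom X Y = 𝟙 _) : t = tensorDualInv X Y := by
  rw [← Category.comp_id t, ← tensorDualHom_inv, ← Category.assoc, h, Category.id_comp]

/-- The nested evaluation of `X ⊗ Y`: two recouplings with a trivial label. -/
theorem tensorDualHom_ev (X Y : S.Obj) :
    tensorMap (tensorDualHom X Y) (𝟙 (X.tensor Y)) ≫ assocHom Y.dual X.dual (X.tensor Y) ≫
      tensorMap (𝟙 Y.dual) (assocInv X.dual X Y ≫ tensorMap (ev X) (𝟙 Y) ≫ leftHom Y) ≫ ev Y =
        ev (X.tensor Y) := by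
  refine hom_ext fun p u => ?_
  obtain ⟨p, q, m, rfl⟩ := exists_pair p
  induction p using toDual_induction with | h p
  obtain ⟨x, y, k, rfl⟩ := exists_pair p
  obtain ⟨x', y', k', rfl⟩ := exists_pair q
  rw [comp_tensorMap_id, sum_entry_tensorDualHom ((isSupported_entry _ u).pair_left _ m),
    comp_assocHom, entry_ev]
  simp only [comp_id_tensorMap, comp_ev, color_pair, color_toDual]
  have h1 : ∀ n, entry (assocInv X.dual X Y ≫ tensorMap (ev X) (𝟙 Y) ≫ leftHom Y)
      (pair (toDual x) (pair x' y' k') n) y =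
      if n = Y.color y' then S.U (R.dual (X.color x)) (X.color x') R.one (Y.color y') n k' *
        (S.sqrtDim (X.color x) * entry (𝟙 X) x x') * entry (𝟙 Y) y' y else 0 := by
    intro n
    rw [comp_assocInv]
    simp only [comp_tensorMap_id, sum_point, entry_leftHom, color_toDual]
    rw [Finset.sum_eq_single R.one]
    · rw [entry_ev, if_pos rfl]
      split_ifs <;> ring
    · intro r _ hr
      simp only [entry_ev, if_neg hr, zero_mul, mul_zero]
    · simp
  simp only [h1, mul_ite, mul_zero, Finset.sum_ite_irrel, Finset.sum_ite_eq', Finset.mem_univ,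
    if_true, Finset.sum_const_zero]
  split_ifs with hm
  swap
  · rfl
  subst hm
  classical
  by_cases hN : R.N (X.color x) (Y.color y) k ≠ 0
  · by_cases hk : k' = k
    · subst hk
      by_cases hx : entry (𝟙 X) x x' = 0
      · have : entry (𝟙 (X.tensor Y)) (pair x y k') (pair x' y' k') = 0 := by
          rw [← tensorMap_id, entry_tensorMap, hx]; simp
        rw [hx, this]; simp
      by_cases hy : entry (𝟙 Y) y' y = 0
      · have : entry (𝟙 (X.tensor Y)) (pair x y k') (pair x' y' k') = 0 := by
          rw [← tensorMap_id, entry_tensorMap, entry_id_comm y, hy]; simp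
        rw [hy, this]; simp
      have h2 : entry (𝟙 (X.tensor Y)) (pair x y k') (pair x' y' k') =
          entry (𝟙 X) x x' * entry (𝟙 Y) y' y := by
        rw [← tensorMap_id, entry_tensorMap, if_pos ⟨rfl, hN⟩, entry_id_comm y]
      rw [h2, ← color_eq hx, color_eq hy, S.V_nested _ _ _ hN, U_nested_eq hN]
      have := S.sqrtDim_ne_zero (X.color x)
      have := S.sqrtDim_ne_zero (Y.color y)
      field_simp
    · have h2 : entry (𝟙 (X.tensor Y)) (pair x y k) (pair x' y' k') = 0 :=
        entry_eq_zero _ fun h1 => hk h1.2.2.symm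
      rw [S.V_zero, h2]
      · simp
      · exact fun ha => hk ((R.N_one_out_ne.mp ha.2.1).trans (R.dual_dual k))
  · have h2 : entry (𝟙 (X.tensor Y)) (pair x y k) (pair x' y' k') = 0 :=
      entry_eq_zero _ fun h1 => hN h1.1.2.2
    rw [S.V_zero, h2]
    · simp
    · exact fun ha => hN ((R.dual_mul _ _ _).symm ▸ ha.1)

theorem rightDualTensorIso_hom_eq (X Y : S.Obj) :
    (rightDualTensorIso X Y).hom = tensorDualHom X Y :=
  eq_rightDualTensorIso_hom _ (tensorDualHom_ev X Y)

theorem rightDualTensorIso_inv_eq (X Y : S.Obj) :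
    (rightDualTensorIso X Y).inv = tensorDualInv X Y := by
  apply eq_tensorDualInv
  rw [← rightDualTensorIso_hom_eq]
  exact (rightDualTensorIso X Y).inv_hom_id

theorem comp_doubleDual_hom {X Z : S.Obj} (h : X.dual.dual ⟶ Z) (x : X.Idx) (w : Z.Idx) :
    entry ((doubleDual X).hom ≫ h) x w = entry h (toDual (toDual x)) w := by
  rw [entry_comp, sum_toDual, sum_toDual]
  exact sum_entry_id ((isSupported_entry h w).comp_toDual).comp_toDual x

/-- The pivotal structure given by the identity matrices. -/
noncomputable def pivotal (S : R.SphericalSymbols) : PivotalStructure S.Obj where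
  iso X := doubleDual X
  naturality {X Y} f := by
    refine hom_ext fun x y => ?_
    induction y using toDual_induction with | h y
    induction y using toDual_induction with | h y
    rw [rightAdjointMate_eq, rightAdjointMate_eq]
    refine Eq.trans ?_ (comp_doubleDual_hom _ x _).symm
    rw [entry_transpose, entry_transpose]
    exact congrFun (congrFun (congrArg entry (Category.comp_id f)) x) y
  tensor X Y := by
    rw [rightDualTensorIso_inv_eq, rightDualTensorIso_hom_eq, rightAdjointMate_eq]
    refine hom_ext fun p q => ?_
    obtain ⟨x, y, k, rfl⟩ := exists_pair p
    induction q using toDual_induction with | h q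
    induction q using toDual_induction with | h q
    have h1 : ∀ (x' : X.Idx) (y' : Y.Idx),
        entry (tensorDualInv Y.dual X.dual ≫ transpose (tensorDualHom X Y))
          (pair (toDual (toDual x')) (toDual (toDual y')) k) (toDual (toDual q)) =
        entry (𝟙 (X.tensor Y)) q (pair x' y' k) := by
      intro x' y'
      rw [comp_tensorDualInv]
      refine (entry_transpose _ _ _).trans ?_
      rw [entry_tensorDualHom, R.dual_dual]
    change entry (doubleDual (X.tensor Y)).hom (pair x y k) (toDual (toDual q)) =
      entry (tensorMap (doubleDual X).hom (doubleDual Y).hom ≫ tensorDualInv Y.dual X.dual ≫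
        transpose (tensorDualHom X Y)) (pair x y k) (toDual (toDual q))
    rw [comp_tensorMap, sum_toDual, sum_toDual, entry_doubleDual_hom]
    have h2 : ∀ x' : X.Idx, ∑ y', entry (doubleDual X).hom x (toDual (toDual x')) *
        entry (doubleDual Y).hom y y' *
        entry (tensorDualInv Y.dual X.dual ≫ transpose (tensorDualHom X Y))
          (pair (toDual (toDual x')) y' k) (toDual (toDual q)) =
        ∑ y', entry (𝟙 X) x x' * entry (𝟙 Y) y y' *
          entry (𝟙 (X.tensor Y)) (pair x' y' k) q := by
      intro x'
      rw [sum_toDual, sum_toDual]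
      refine Finset.sum_congr rfl fun y' _ => ?_
      rw [h1, entry_doubleDual_hom, entry_doubleDual_hom]
      exact congrArg _ (entry_id_comm (X := X.tensor Y) q _)
    simp only [h2]
    rw [← comp_tensorMap, tensorMap_id, Category.comp_id]

/-- Both traces of an endomorphism are the sum of its diagonal entries, weighted with the
dimensions of the summands. -/
theorem traceRight_eq {X : S.Obj} (f : X ⟶ X) (u w : (simple S R.one).Idx) :
    entry ((pivotal S).traceRight f) u w = ∑ x : X.Idx, (S.d (X.color x) : ℂ) * entry f x x := by
  change entry (coev X ≫ tensorMap (f ≫ (doubleDual X).hom) (𝟙 X.dual) ≫ ev X.dual) u w = _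
  rw [comp_coev]
  refine Finset.sum_congr rfl fun x _ => ?_
  rw [comp_tensorMap_id, sum_toDual, sum_toDual]
  have h1 : ∀ x' : X.Idx, entry (f ≫ (doubleDual X).hom) x (toDual (toDual x')) = entry f x x' :=
    fun x' => congrFun (congrFun (congrArg entry (Category.comp_id f)) x) x'
  have h2 : ∀ x' : X.Idx, entry (ev X.dual) (pair (toDual (toDual x')) (toDual x) R.one) w =
      S.sqrtDim (X.color x') * entry (𝟙 X) x' x := by
    intro x'
    rw [entry_ev, if_pos rfl, color_toDual, sqrtDim_dual]
    rfl
  simp only [h1, h2]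
  have h3 : ∀ x', entry f x x' * (S.sqrtDim (X.color x') * entry (𝟙 X) x' x) =
      S.sqrtDim (X.color x) * (entry f x x' * entry (𝟙 X) x' x) := by
    intro x'
    by_cases h0 : entry f x x' = 0
    · simp [h0]
    · rw [color_eq h0]; ring
  simp only [h3, ← Finset.mul_sum]
  rw [← entry_comp, Category.comp_id, ← mul_assoc, sqrtDim_mul_self]

theorem traceLeft_eq {X : S.Obj} (f : X ⟶ X) (u w : (simple S R.one).Idx) :
    entry ((pivotal S).traceLeft f) u w = ∑ x : X.Idx, (S.d (X.color x) : ℂ) * entry f x x := by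
  change entry (coev X.dual ≫ tensorMap (𝟙 X.dual) ((doubleDual X).inv ≫ f) ≫ ev X) u w = _
  rw [comp_coev, sum_toDual]
  refine Finset.sum_congr rfl fun x _ => ?_
  rw [comp_id_tensorMap, comp_ev, if_pos rfl, color_toDual, sqrtDim_dual, ← mul_assoc,
    sqrtDim_mul_self]
  congr 1
  exact congrFun (congrFun (congrArg entry (Category.id_comp f)) x) x

/-- The left and the right trace agree because `d i* = d i`. -/
theorem pivotal_isSpherical (S : R.SphericalSymbols) : (pivotal S).IsSpherical := fun _ f =>
  hom_ext fun u w => (traceLeft_eq f u w).trans (traceRight_eq f u w).symm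

theorem entry_id_point (i : I) : entry (𝟙 (simple S i)) (point S i) (point S i) = 1 := by
  classical
  rw [entry_id, if_pos ⟨rfl, trivial⟩]

theorem dim_simple (i : I) : (pivotal S).dim (simple S i) = (S.d i : ℂ) • 𝟙 (𝟙_ S.Obj) := by
  refine hom_ext fun u w => ?_
  refine (traceRight_eq _ u w).trans ?_
  rw [sum_point, entry_smul, entry_id_point, color_point]
  exact congrArg _ (entry_id_point (S := S) R.one).symm

theorem dim_simple_dual (i : I) :
    (pivotal S).dim (simple S i)ᘁ = (S.d i : ℂ) • 𝟙 (𝟙_ S.Obj) := by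
  refine hom_ext fun u w => ?_
  refine (traceRight_eq _ u w).trans ?_
  refine (sum_point (S := S) (i := i) _).trans ?_
  change ((S.d (R.dual i) : ℝ) : ℂ) * entry (𝟙 (simple S i).dual) _ _ = _
  rw [S.d_dual, entry_smul]
  exact congrArg _ ((entry_id_point (S := S) i).trans (entry_id_point (S := S) R.one).symm)

end FusionRing.SphericalSymbols.Obj

/-! ### The category is abelian -/

namespace FusionRing.SphericalSymbols.Obj

variable {I : Type u} [Fintype I] [DecidableEq I] {R : FusionRing I} {S : R.SphericalSymbols}

/-- The multiplicity space of the label `i` in an object. -/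
def multiplicitySpace (X : S.Obj) (i : I) : Submodule ℂ (X.Idx → ℂ) where
  carrier := {g | ∀ x, ¬ (X.supp x ∧ X.color x = i) → g x = 0}
  add_mem' hf hg x h := by simp [hf x h, hg x h]
  zero_mem' x _ := rfl
  smul_mem' c f hf x h := by simp [hf x h]

theorem multiplicitySpace.ext {X : S.Obj} {i : I} {g h : X.multiplicitySpace i}
    (H : ∀ x, g.1 x = h.1 x) : g = h := Subtype.ext (funext H)

/-- The map of multiplicity spaces induced by a morphism. -/
noncomputable def multiplicityMap {X Y : S.Obj} (f : X ⟶ Y) (i : I) :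
    X.multiplicitySpace i →ₗ[ℂ] Y.multiplicitySpace i where
  toFun g := ⟨fun y => ∑ x, g.1 x * entry f x y, fun y h => Finset.sum_eq_zero fun x _ => by
    by_cases h1 : X.supp x ∧ X.color x = i
    · rw [entry_eq_zero f fun h2 => h ⟨h2.2.1, h2.2.2.symm.trans h1.2⟩, mul_zero]
    · rw [g.2 x h1, zero_mul]⟩
  map_add' g h := multiplicitySpace.ext fun y => by
    simp [add_mul, Finset.sum_add_distrib]
  map_smul' c g := multiplicitySpace.ext fun y => by
    simp [mul_assoc, Finset.mul_sum]

theorem multiplicityMap_apply {X Y : S.Obj} (f : X ⟶ Y) (i : I) (g : X.multiplicitySpace i)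
    (y : Y.Idx) : (multiplicityMap f i g).1 y = ∑ x, g.1 x * entry f x y := rfl

/-- The functor of multiplicity spaces. -/
noncomputable def multiplicityFunctor (S : R.SphericalSymbols) :
    S.Obj ⥤ (Discrete I ⥤ FGModuleCat.{u} ℂ) where
  obj X := Discrete.functor fun i => FGModuleCat.of ℂ (X.multiplicitySpace i)
  map f := Discrete.natTrans fun i => FGModuleCat.ofHom (multiplicityMap f i.as)
  map_id X := by
    ext ⟨i⟩ g
    refine multiplicitySpace.ext fun y => ?_
    refine Eq.trans ?_ (sum_mul_entry_id (X := X) (g := g.1) (fun x hx => g.2 x fun h => hx h.1) y)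
    exact Finset.sum_congr rfl fun x _ => mul_comm _ _
  map_comp {X Y Z} f h := by
    ext ⟨i⟩ g
    refine multiplicitySpace.ext fun z => ?_
    change ∑ x, g.1 x * entry (f ≫ h) x z = ∑ y, (∑ x, g.1 x * entry f x y) * entry h y z
    simp only [entry_comp, Finset.mul_sum, Finset.sum_mul, mul_assoc]
    exact Finset.sum_comm

/-- The basis vector of the multiplicity space given by a summand. -/
noncomputable def basisVector {X : S.Obj} (x : X.Idx) (hx : X.supp x) :
    X.multiplicitySpace (X.color x) :=
  ⟨Pi.single x 1, fun y h => Pi.single_eq_of_ne (by rintro rfl; exact h ⟨hx, rfl⟩) _⟩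

theorem multiplicityMap_basisVector {X Y : S.Obj} (f : X ⟶ Y) {x : X.Idx} (hx : X.supp x)
    (y : Y.Idx) : (multiplicityMap f _ (basisVector x hx)).1 y = entry f x y := by
  rw [multiplicityMap_apply]
  simp [basisVector, Pi.single_apply]

instance : (multiplicityFunctor S).Faithful where
  map_injective {X Y f h} H := by
    refine hom_ext fun x y => ?_
    by_cases hx : X.supp x
    · rw [← multiplicityMap_basisVector f hx, ← multiplicityMap_basisVector h hx]
      have h1 := congrArg (fun t => t.app ⟨X.color x⟩) H
      have h2 : multiplicityMap f (X.color x) = multiplicityMap h (X.color x) :=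
        congrArg (fun t => t.hom.hom) h1
      rw [h2]
    · rw [entry_eq_zero f fun h1 => hx h1.1, entry_eq_zero h fun h1 => hx h1.1]

/-- A family of linear maps of the multiplicity spaces is given by the matrix of its values at the
basis vectors. -/
theorem eq_sum_basisVector {X : S.Obj} {i : I} (g : X.multiplicitySpace i) {Y : S.Obj}
    (φ : ∀ j, X.multiplicitySpace j →ₗ[ℂ] Y.multiplicitySpace j) (y : Y.Idx)
    (A : X.Idx → ℂ) (hA : ∀ x (hx : X.supp x), A x = (φ _ (basisVector x hx)).1 y) :
    ∑ x, g.1 x * A x = (φ i g).1 y := by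
  classical
  have h1 : g = ∑ x : X.Idx, if h : X.supp x ∧ X.color x = i then
      g.1 x • (h.2 ▸ basisVector x h.1 : X.multiplicitySpace i) else 0 := by
    refine multiplicitySpace.ext fun z => ?_
    have h2 : ∀ x : X.Idx, ((if h : X.supp x ∧ X.color x = i then
      g.1 x • (h.2 ▸ basisVector x h.1 : X.multiplicitySpace i) else 0 :
        X.multiplicitySpace i)).1 z = if x = z then g.1 z else 0 := by
      intro x
      split_ifs with h3 h4 h4
      · obtain ⟨h5, rfl⟩ := h3
        subst h4
        simp [basisVector]
      · obtain ⟨h5, rfl⟩ := h3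
        simp [basisVector, Ne.symm h4]
      · subst h4
        exact (g.2 x h3).symm
      · rfl
    rw [Submodule.coe_sum, Finset.sum_apply]
    simp only [h2, Finset.sum_ite_eq', Finset.mem_univ, if_true]
  conv_rhs => rw [h1]
  rw [map_sum, Submodule.coe_sum, Finset.sum_apply]
  refine Finset.sum_congr rfl fun x _ => ?_
  split_ifs with h3
  · obtain ⟨h5, rfl⟩ := h3
    rw [hA x h5]
    simp
  · rw [g.2 x h3]
    simp

instance : (multiplicityFunctor S).Full where
  map_surjective {X Y} φ := by
    classical
    let ψ : ∀ j, X.multiplicitySpace j →ₗ[ℂ] Y.multiplicitySpace j := fun j => (φ.app ⟨j⟩).hom.hom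
    let f : X ⟶ Y := homMk (fun x y => if h : X.supp x then (ψ _ (basisVector x h)).1 y else 0) (by
      intro x y h
      split_ifs with hx
      · exact (ψ _ (basisVector x hx)).2 y fun h1 => h ⟨hx, h1.1, h1.2.symm⟩
      · rfl)
    refine ⟨f, ?_⟩
    ext ⟨i⟩ g
    refine multiplicitySpace.ext fun y => ?_
    exact eq_sum_basisVector g ψ y _ fun x hx => dif_pos hx

/-- The object with given multiplicities. -/
noncomputable def ofMultiplicities (S : R.SphericalSymbols) (m : I → ℕ) : S.Obj where
  code := .fin (Fintype.card (Σ i, Fin (m i)))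
  color x := ((Fintype.equivFin (Σ i, Fin (m i))).symm x.down).1
  supp _ := True

theorem finrank_multiplicitySpace_ofMultiplicities (m : I → ℕ) (i : I) :
    Module.finrank ℂ ((ofMultiplicities S m).multiplicitySpace i) = m i := by
  classical
  let e : (ofMultiplicities S m).Idx ≃ Σ i, Fin (m i) :=
    Equiv.ulift.trans (Fintype.equivFin (Σ i, Fin (m i))).symm
  have hc : ∀ x, (ofMultiplicities S m).color x = (e x).1 := fun _ => rfl
  let w : (Fin (m i) → ℂ) → (Σ i, Fin (m i)) → ℂ := fun v s =>
    if h : s.1 = i then v (h ▸ s.2) else 0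
  let φ : (ofMultiplicities S m).multiplicitySpace i ≃ₗ[ℂ] (Fin (m i) → ℂ) :=
    { toFun := fun g a => g.1 (e.symm ⟨i, a⟩)
      invFun := fun v => ⟨fun x => w v (e x), fun x h => dif_neg fun h1 => h ⟨trivial, h1⟩⟩
      map_add' := fun _ _ => rfl
      map_smul' := fun _ _ => rfl
      left_inv := fun g => multiplicitySpace.ext fun x => by
        obtain ⟨⟨j, a⟩, rfl⟩ := e.symm.surjective x
        simp only [Equiv.apply_symm_apply]
        by_cases h : j = i
        · subst h; simp [w]
        · have h0 := g.2 (e.symm ⟨j, a⟩) fun h1 => h (by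
            have h2 := h1.2
            rw [hc] at h2
            simpa using h2)
          simp [w, h, h0]
      right_inv := fun v => by
        funext a
        simp [w] }
  rw [φ.finrank_eq, Module.finrank_fin_fun]

instance : (multiplicityFunctor S).EssSurj where
  mem_essImage D := by
    let m : I → ℕ := fun i => Module.finrank ℂ (D.obj ⟨i⟩)
    refine ⟨ofMultiplicities S m, ⟨Discrete.natIso fun i => ?_⟩⟩
    have h := finrank_multiplicitySpace_ofMultiplicities (S := S) m i.as
    exact (LinearEquiv.ofFinrankEq _ _ h).toFGModuleCatIso

instance : (multiplicityFunctor S).IsEquivalence where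

/-- The category is equivalent to a category of families of finite dimensional vector spaces,
from which it inherits kernels and cokernels. The preadditive structure is the one of matrices. -/
noncomputable instance : Abelian S.Obj :=
  have : HasFiniteProducts S.Obj := ⟨fun _ =>
    Adjunction.hasLimitsOfShape_of_equivalence (multiplicityFunctor S)⟩
  let A : Abelian S.Obj := abelianOfEquivalence (multiplicityFunctor S)
  { toPreadditive := inferInstance
    toIsNormalMonoCategory := A.toIsNormalMonoCategory
    toIsNormalEpiCategory := A.toIsNormalEpiCategory
    has_finite_products := inferInstance
    has_kernels := A.has_kernels
    has_cokernels := A.has_cokernels }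

end FusionRing.SphericalSymbols.Obj

/-! ### Semisimplicity and the fusion rules -/

namespace FusionRing.SphericalSymbols.Obj

variable {I : Type u} [Fintype I] [DecidableEq I] {R : FusionRing I} {S : R.SphericalSymbols}

theorem tensorMap_add {X Y X' Y' : S.Obj} (f : X ⟶ Y) (g h : X' ⟶ Y') :
    tensorMap f (g + h) = tensorMap f g + tensorMap f h := hom_ext fun p q => by
  obtain ⟨x, x', k, rfl⟩ := exists_pair p
  obtain ⟨y, y', k', rfl⟩ := exists_pair q
  rw [entry_add]
  simp only [entry_tensorMap, entry_add]
  split_ifs <;> ring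

theorem add_tensorMap {X Y X' Y' : S.Obj} (f g : X ⟶ Y) (h : X' ⟶ Y') :
    tensorMap (f + g) h = tensorMap f h + tensorMap g h := hom_ext fun p q => by
  obtain ⟨x, x', k, rfl⟩ := exists_pair p
  obtain ⟨y, y', k', rfl⟩ := exists_pair q
  rw [entry_add]
  simp only [entry_tensorMap, entry_add]
  split_ifs <;> ring

theorem tensorMap_smul {X Y X' Y' : S.Obj} (f : X ⟶ Y) (c : ℂ) (g : X' ⟶ Y') :
    tensorMap f (c • g) = c • tensorMap f g := hom_ext fun p q => by
  obtain ⟨x, x', k, rfl⟩ := exists_pair p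
  obtain ⟨y, y', k', rfl⟩ := exists_pair q
  rw [entry_smul]
  simp only [entry_tensorMap, entry_smul]
  split_ifs <;> ring

theorem smul_tensorMap {X Y X' Y' : S.Obj} (c : ℂ) (f : X ⟶ Y) (g : X' ⟶ Y') :
    tensorMap (c • f) g = c • tensorMap f g := hom_ext fun p q => by
  obtain ⟨x, x', k, rfl⟩ := exists_pair p
  obtain ⟨y, y', k', rfl⟩ := exists_pair q
  rw [entry_smul]
  simp only [entry_tensorMap, entry_smul]
  split_ifs <;> ring

instance : MonoidalPreadditive S.Obj where
  whiskerLeft_zero {X Y Z} := by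
    have h := tensorMap_smul (𝟙 X) (0 : ℂ) (0 : Y ⟶ Z)
    rwa [zero_smul, zero_smul] at h
  zero_whiskerRight {X Y Z} := by
    have h := smul_tensorMap (0 : ℂ) (0 : Y ⟶ Z) (𝟙 X)
    rwa [zero_smul, zero_smul] at h
  whiskerLeft_add {X _ _} f g := tensorMap_add (𝟙 X) f g
  add_whiskerRight {X _ _} f g := add_tensorMap f g (𝟙 X)

instance : MonoidalLinear ℂ S.Obj where
  whiskerLeft_smul X _ _ c f := tensorMap_smul (𝟙 X) c f
  smul_whiskerRight c _ _ f X := smul_tensorMap c f (𝟙 X)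

/-- The inclusion of a summand. -/
noncomputable def incl {X : S.Obj} (x : X.Idx) : simple S (X.color x) ⟶ X :=
  homMk (fun _ y => entry (𝟙 X) x y) fun _ _ h => entry_eq_zero _ fun h1 =>
    h ⟨trivial, h1.2.1, h1.2.2⟩

/-- The projection to a summand. -/
noncomputable def proj {X : S.Obj} (x : X.Idx) : X ⟶ simple S (X.color x) :=
  homMk (fun y _ => entry (𝟙 X) y x) fun _ _ h => entry_eq_zero _ fun h1 =>
    h ⟨h1.1, trivial, h1.2.2⟩

theorem entry_incl_proj {X : S.Obj} (x y : X.Idx) (u w) :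
    entry (incl x ≫ proj y) u w = entry (𝟙 X) x y :=
  congrFun (congrFun (congrArg entry (Category.comp_id (𝟙 X))) x) y

theorem incl_proj_self {X : S.Obj} {x : X.Idx} (hx : X.supp x) : incl x ≫ proj x = 𝟙 _ := by
  classical
  refine hom_ext fun u w => ?_
  rw [entry_incl_proj, entry_id, if_pos ⟨rfl, hx⟩]
  exact (entry_id_point _).symm

theorem incl_proj_ne {X : S.Obj} {x y : X.Idx} (h : x ≠ y) : incl x ≫ proj y = 0 := by
  classical
  refine hom_ext fun u w => ?_
  rw [entry_incl_proj, entry_id, if_neg fun h1 => h h1.1, entry_zero]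

theorem hom_simple_eq_zero_iff {i j : I} (f : simple S i ⟶ simple S j) :
    f = 0 ↔ entry f (point S i) (point S j) = 0 :=
  ⟨fun h => by rw [h, entry_zero], fun h => hom_ext fun _ _ => h⟩

theorem id_simple_ne_zero (i : I) : 𝟙 (simple S i) ≠ 0 := by
  rw [Ne, hom_simple_eq_zero_iff, entry_id_point]
  exact one_ne_zero

/-- A nonzero morphism to a simple object has a section. -/
theorem exists_section {Y : S.Obj} {i : I} {f : Y ⟶ simple S i} (hf : f ≠ 0) :
    ∃ s : simple S i ⟶ Y, s ≫ f = 𝟙 _ := by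
  have h1 : ∃ y, entry f y (point S i) ≠ 0 := by
    by_contra! h1
    exact hf (hom_ext fun y u => h1 y)
  obtain ⟨y, hy⟩ := h1
  have hc : Y.color y = i := color_eq hy
  subst hc
  refine ⟨(entry f y (point S (Y.color y)))⁻¹ • incl y, hom_ext fun u w => ?_⟩
  rw [Linear.smul_comp, entry_smul]
  have h2 : entry (incl y ≫ f) u w = entry f y (point S (Y.color y)) :=
    congrFun (congrFun (congrArg entry (Category.id_comp f)) y) _
  rw [h2, inv_mul_cancel₀ hy]
  exact (entry_id_point _).symm

instance simple_simple (i : I) : Simple (simple S i) where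
  mono_isIso_iff_nonzero {Y} f _ := by
    refine ⟨fun _ h0 => id_simple_ne_zero (S := S) i ?_, fun hf => ?_⟩
    · exact (IsIso.inv_hom_id f).symm.trans
        ((congrArg (fun g => inv f ≫ g) h0).trans comp_zero)
    · obtain ⟨s, hs⟩ := exists_section hf
      have : IsSplitEpi f := ⟨⟨⟨s, hs⟩⟩⟩
      exact isIso_of_mono_of_isSplitEpi f

theorem exists_iso_simple (Y : S.Obj) [Simple Y] : ∃ i, Nonempty (Y ≅ simple S i) := by
  have h1 : ∃ y, Y.supp y := by
    by_contra! h1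
    exact id_nonzero Y (hom_ext fun y _ => entry_eq_zero _ fun h2 => h1 y h2.1)
  obtain ⟨y, hy⟩ := h1
  have h2 := incl_proj_self hy
  have : IsSplitMono (incl y) := ⟨⟨⟨proj y, h2⟩⟩⟩
  have h3 : incl y ≠ 0 := fun h0 => id_simple_ne_zero (S := S) (Y.color y) (by
    rw [← h2, h0, zero_comp])
  have : IsIso (incl y) := isIso_of_mono_of_nonzero h3
  exact ⟨_, ⟨(asIso (incl y)).symm⟩⟩

theorem eq_of_iso_simple {i j : I} (e : simple S i ≅ simple S j) : i = j := by
  have h : e.hom ≠ 0 := fun h0 => id_simple_ne_zero (S := S) i (by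
    rw [← e.hom_inv_id, h0, zero_comp])
  rw [Ne, hom_simple_eq_zero_iff] at h
  exact color_eq h

attribute [local instance] Abelian.hasFiniteBiproducts

/-- An object is the direct sum of its summands. -/
theorem exists_iso_biproduct (X : S.Obj) : ∃ (n : ℕ) (T : Fin n → S.Obj),
    (∀ i, Simple (T i)) ∧ Nonempty (X ≅ ⨁ T) := by
  classical
  let e := Fintype.equivFin {x : X.Idx // X.supp x}
  let c : Fin (Fintype.card {x : X.Idx // X.supp x}) → X.Idx := fun a => (e.symm a).1
  have hc : ∀ a, X.supp (c a) := fun a => (e.symm a).2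
  have hinj : ∀ {a b}, c a = c b → a = b := fun h => e.symm.injective (Subtype.ext h)
  refine ⟨_, fun a => simple S (X.color (c a)), fun a => simple_simple _, ⟨?_⟩⟩
  refine ⟨biproduct.lift fun a => proj (c a), biproduct.desc fun a => incl (c a), ?_, ?_⟩
  · rw [biproduct.lift_desc]
    refine hom_ext fun x y => ?_
    rw [entry_sum]
    have h1 : ∀ a, entry (proj (c a) ≫ incl (c a)) x y =
        entry (𝟙 X) x (c a) * entry (𝟙 X) (c a) y := fun a => by
      rw [entry_comp, sum_point]; rfl
    simp only [h1]
    rw [← sum_entry_id (isSupported_entry (𝟙 X) y) x, ← Equiv.sum_comp e]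
    have h2 : ∀ a, c (e a) = a.1 := fun a => congrArg Subtype.val (e.symm_apply_apply a)
    simp only [h2]
    refine (Finset.sum_subtype (Finset.univ.filter X.supp) (by simp)
      (fun z => entry (𝟙 X) x z * entry (𝟙 X) z y)).symm.trans (Finset.sum_filter_of_ne ?_)
    intro z _ hz
    by_contra hs
    exact hz (by rw [entry_eq_zero (𝟙 X) (x := z) fun h2 => hs h2.1, mul_zero])
  · refine biproduct.hom_ext' _ _ fun a => biproduct.hom_ext _ _ fun b => ?_
    rw [biproduct.ι_desc_assoc, Category.assoc, biproduct.lift_π, Category.comp_id]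
    by_cases hab : a = b
    · subst hab
      rw [biproduct.ι_π_self, incl_proj_self (hc a)]
    · rw [biproduct.ι_π_ne _ hab, incl_proj_ne fun h => hab (hinj h)]

instance : FusionCategory S.Obj where
  finiteDimensional_hom X Y := inferInstance
  semisimple X := exists_iso_biproduct X
  finite_simples := by
    let e := Fintype.equivFin I
    refine ⟨_, fun a => simple S (e.symm a), fun Y hY => ?_⟩
    obtain ⟨i, hi⟩ := exists_iso_simple Y
    exact ⟨e i, by simpa only [e.symm_apply_apply] using hi⟩
  simple_unit := simple_simple R.one

/-- The vertex `X i ⊗ X j ⟶ X k`. The factor `1 / √(d k)` is the change of gauge from the recoupling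
coefficients `U` to the F-symbols. -/
noncomputable def vertex (S : R.SphericalSymbols) (i j k : I) :
    (simple S i).tensor (simple S j) ⟶ simple S k :=
  homMk (fun p _ => if p.2.2 = k ∧ R.N i j k ≠ 0 then (S.sqrtDim k)⁻¹ else 0) (by
  rintro ⟨u, w, m⟩ ⟨⟩ h
  refine if_neg ?_
  rintro ⟨rfl, hN⟩
  exact h ⟨⟨trivial, trivial, hN⟩, trivial, rfl⟩)

theorem entry_vertex (i j k : I) (u w m t) :
    entry (vertex S i j k) (pair u w m) t =
      if m = k ∧ R.N i j k ≠ 0 then (S.sqrtDim k)⁻¹ else 0 := rfl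

theorem vertex_ne_zero {i j k : I} (h : R.N i j k ≠ 0) : vertex S i j k ≠ 0 := by
  intro h0
  have h1 : entry (vertex S i j k) (pair (point S i) (point S j) k) (point S k) = 0 := by
    rw [h0, entry_zero]
  rw [entry_vertex, if_pos ⟨rfl, h⟩] at h1
  exact inv_ne_zero (S.sqrtDim_ne_zero k) h1

theorem finrank_hom_simple (hR : R.MultiplicityOne) (i j k : I) :
    Module.finrank ℂ ((simple S i).tensor (simple S j) ⟶ simple S k) = R.N i j k := by
  by_cases h : R.N i j k = 0
  · have : Subsingleton ((simple S i).tensor (simple S j) ⟶ simple S k) := by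
      refine ⟨fun f g => hom_ext fun p w => ?_⟩
      obtain ⟨u, u', m, rfl⟩ := exists_pair p
      have h1 : ¬ (((simple S i).tensor (simple S j)).supp (pair u u' m) ∧ (simple S k).supp w ∧
          m = k) := by
        rintro ⟨h1, -, rfl⟩
        exact h1.2.2 h
      rw [entry_eq_zero f h1, entry_eq_zero g h1]
    rw [h, Module.finrank_zero_of_subsingleton]
  · have h1 : R.N i j k = 1 := le_antisymm (hR i j k) (Nat.one_le_iff_ne_zero.mpr h)
    rw [h1]
    refine finrank_eq_one (vertex S i j k) (vertex_ne_zero h) fun f => ?_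
    refine ⟨entry f (pair (point S i) (point S j) k) (point S k) * S.sqrtDim k,
      hom_ext fun p w => ?_⟩
    obtain ⟨u, u', m, rfl⟩ := exists_pair p
    rw [entry_smul, entry_vertex]
    by_cases hm : m = k
    · subst hm
      rw [if_pos ⟨rfl, h⟩, mul_assoc, mul_inv_cancel₀ (S.sqrtDim_ne_zero m), _root_.mul_one]
      rfl
    · have h0 : entry f (pair u u' m) w = 0 := entry_eq_zero f fun h2 => hm h2.2.2
      rw [if_neg fun h2 => hm h2.1, mul_zero, h0]

theorem isCategorification (hR : R.MultiplicityOne) (S : R.SphericalSymbols) :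
    R.IsCategorification (simple S) where
  simple i := simple_simple i
  injective _ _ := fun ⟨e⟩ => eq_of_iso_simple e
  surjective Y _ := exists_iso_simple Y
  unit := ⟨Iso.refl _⟩
  dual _ := ⟨Iso.refl _⟩
  multiplicity i j k := finrank_hom_simple hR i j k

/-- Expanding the associator by the symbols `V` turns the relation of the vertices into the
orthogonality of `U` and `V`. -/
theorem realizesFSymbols (S : R.SphericalSymbols) (F : I → I → I → I → I → I → ℂ)
    (hF : ∀ i₁ i₂ i₃ i₄ i₅ i₆, F i₁ i₂ i₃ i₄ i₅ i₆ * (S.sqrtDim i₆)⁻¹ =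
      S.U i₁ i₂ i₃ i₄ i₅ i₆ * (S.sqrtDim i₃)⁻¹) :
    R.RealizesFSymbols (simple S) F := by
  refine ⟨vertex S, fun _ _ _ => vertex_ne_zero, fun a b c e f => ?_⟩
  change tensorMap (vertex S a b c) (𝟙 (simple S e)) ≫ vertex S c e f =
    ∑ g, F a b c e f g • (assocHom (simple S a) (simple S b) (simple S e) ≫
      tensorMap (𝟙 (simple S a)) (vertex S b e g) ≫ vertex S a g f)
  refine hom_ext fun p w => ?_
  obtain ⟨p, t, k, rfl⟩ := exists_pair p
  obtain ⟨u, v, m, rfl⟩ := exists_pair p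
  rw [entry_sum, comp_tensorMap_id, sum_point, entry_vertex, entry_vertex]
  have h1 : ∀ g, entry (F a b c e f g • (assocHom (simple S a) (simple S b) (simple S e) ≫
      tensorMap (𝟙 (simple S a)) (vertex S b e g) ≫ vertex S a g f)) (pair (pair u v m) t k) w =
      if k = f then (S.sqrtDim c)⁻¹ * (S.sqrtDim f)⁻¹ * (S.U a b c e f g * S.V a b m e f g)
        else 0 := by
    intro g
    rw [entry_smul, comp_assocHom]
    simp only [comp_id_tensorMap, sum_point, entry_vertex]
    by_cases hk : k = f
    swap
    · simp [hk]
    subst hk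
    by_cases hA : R.Admissible a b c e k g
    · simp only [hA.2.2.1, hA.2.2.2, ne_eq, not_false_eq_true, and_true, if_true, ite_mul,
        zero_mul, mul_ite, mul_zero, Finset.sum_ite_eq', Finset.mem_univ]
      change F a b c e k g * (S.V a b m e k g * ((S.sqrtDim g)⁻¹ * (S.sqrtDim k)⁻¹)) = _
      linear_combination (S.V a b m e k g * (S.sqrtDim k)⁻¹) * hF a b c e k g
    · have hU := S.U_zero _ _ _ _ _ _ hA
      have h0 := hF a b c e k g
      rw [hU, zero_mul, mul_eq_zero, or_iff_left (inv_ne_zero (S.sqrtDim_ne_zero g))] at h0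
      rw [hU, h0]
      simp
  simp only [h1]
  rw [Finset.sum_ite_irrel, ← Finset.mul_sum, S.U_mul_V, Finset.sum_const_zero]
  grind

end FusionRing.SphericalSymbols.Obj

/-! ### Pseudo-unitarity and unitarity -/

open scoped MatrixOrder ComplexOrder in
/-- The square root of the positive semidefinite matrix `f * fᴴ` has zero rows where `f` has. -/
theorem Matrix.exists_isHermitian_mul_self_eq {m n : Type*} [Fintype m] [Fintype n]
    (f : Matrix m n ℂ) :
    ∃ g : Matrix m m ℂ, (∀ x y, (starRingEnd ℂ) (g y x) = g x y) ∧ g * g = f * f.conjTranspose ∧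
      ∀ x, (∀ y, f x y = 0) → ∀ z, g x z = 0 := by
  classical
  have hA := Matrix.posSemidef_self_mul_conjTranspose f
  have hG : (CFC.sqrt (f * f.conjTranspose)).IsHermitian :=
    (Matrix.nonneg_iff_posSemidef.mp (CFC.sqrt_nonneg (f * f.conjTranspose))).isHermitian
  have hGG := CFC.sqrt_mul_sqrt_self (f * f.conjTranspose) hA.nonneg
  generalize CFC.sqrt (f * f.conjTranspose) = g at hG hGG
  have hg : ∀ x y, (starRingEnd ℂ) (g y x) = g x y := fun x y => hG.apply x y
  refine ⟨g, hg, hGG, fun x hx z => ?_⟩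
  -- the diagonal entry of `g * g` at `x` is the square norm of the row of `g` at `x`
  have h1 : ∑ y, g x y * g y x = 0 := by
    rw [← Matrix.mul_apply, hGG, Matrix.mul_apply]
    exact Finset.sum_eq_zero fun y _ => by rw [hx y, zero_mul]
  have h2 : ∑ y, Complex.normSq (g x y) = 0 := by
    rw [← Complex.ofReal_eq_zero, Complex.ofReal_sum, ← h1]
    exact Finset.sum_congr rfl fun y _ => by rw [← hg y x, Complex.mul_conj]
  exact Complex.normSq_eq_zero.mp
    ((Finset.sum_eq_zero_iff_of_nonneg fun y _ => Complex.normSq_nonneg _).mp h2 z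
      (Finset.mem_univ z))

namespace FusionRing

variable {I : Type u} [Fintype I] [DecidableEq I] {R : FusionRing I}

namespace SphericalSymbols

variable {S : R.SphericalSymbols}

namespace Obj

theorem isPseudoUnitary (S : R.SphericalSymbols) (hS : ∀ i, S.d i = R.FPdim i) :
    R.IsPseudoUnitary (simple S) (pivotal S) := by
  unfold IsPseudoUnitary
  simp only [dim_simple, dim_simple_dual, Linear.comp_smul, Category.comp_id,
    smul_smul, ← Finset.sum_smul]
  congr 1
  rw [totalFPdim, Complex.ofReal_sum]
  exact Finset.sum_congr rfl fun i _ => by rw [hS, Complex.ofReal_pow, sq]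

/-- The adjoint of a morphism: the conjugate transpose. -/
def adjoint {X Y : S.Obj} (f : X ⟶ Y) : Y ⟶ X :=
  homMk (fun y x => (starRingEnd ℂ) (entry f x y)) fun _ _ h => by
    rw [entry_eq_zero f fun h1 => h ⟨h1.2.1, h1.1, h1.2.2.symm⟩, map_zero]

theorem entry_adjoint {X Y : S.Obj} (f : X ⟶ Y) (y : Y.Idx) (x : X.Idx) :
    entry (adjoint f) y x = (starRingEnd ℂ) (entry f x y) := rfl

theorem adjoint_adjoint {X Y : S.Obj} (f : X ⟶ Y) : adjoint (adjoint f) = f :=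
  hom_ext fun _ _ => Complex.conj_conj _

theorem adjoint_comp {X Y Z : S.Obj} (f : X ⟶ Y) (g : Y ⟶ Z) :
    adjoint (f ≫ g) = adjoint g ≫ adjoint f := by
  refine hom_ext fun z x => ?_
  simp only [entry_adjoint, entry_comp, map_sum, map_mul, mul_comm]

theorem adjoint_add {X Y : S.Obj} (f g : X ⟶ Y) : adjoint (f + g) = adjoint f + adjoint g :=
  hom_ext fun _ _ => map_add _ _ _

theorem adjoint_smul {X Y : S.Obj} (c : ℂ) (f : X ⟶ Y) :
    adjoint (c • f) = (starRingEnd ℂ) c • adjoint f :=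
  hom_ext fun _ _ => map_mul _ _ _

theorem eq_zero_of_comp_adjoint {X Y : S.Obj} (f : X ⟶ Y) (h : f ≫ adjoint f = 0) : f = 0 := by
  refine hom_ext fun x y => ?_
  have h1 : ∑ y, Complex.normSq (entry f x y) = 0 := by
    rw [← Complex.ofReal_eq_zero, Complex.ofReal_sum, ← entry_zero (X := X) (Y := X) x x, ← h,
      entry_comp]
    exact Finset.sum_congr rfl fun y _ => by rw [entry_adjoint, Complex.mul_conj]
  exact Complex.normSq_eq_zero.mp
    ((Finset.sum_eq_zero_iff_of_nonneg fun y _ => Complex.normSq_nonneg _).mp h1 y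
      (Finset.mem_univ y))

/-- The square root of `f ≫ f†` is formed separately on each isotypic component. -/
theorem exists_comp_adjoint_eq {X Y : S.Obj} (f : X ⟶ Y) :
    ∃ g : X ⟶ X, f ≫ adjoint f = g ≫ adjoint g := by
  choose G hG hGG hG0 using fun i : I => Matrix.exists_isHermitian_mul_self_eq
    (Matrix.of fun (x : X.Idx) (y : Y.Idx) => if X.color x = i then entry f x y else 0)
  have h0 : ∀ i x, ¬ (X.supp x ∧ X.color x = i) → ∀ z, G i x z = 0 := fun i x hx =>
    hG0 i x fun y => by
      rw [Matrix.of_apply]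
      split_ifs with hc
      · exact entry_eq_zero f fun h1 => hx ⟨h1.1, hc⟩
      · rfl
  refine ⟨homMk (fun x x' => G (X.color x) x x') fun x x' h => ?_, hom_ext fun x z => ?_⟩
  · by_cases hx : X.supp x
    · rw [← hG, h0 _ x' fun h1 => h ⟨hx, h1.1, h1.2.symm⟩, map_zero]
    · exact h0 _ x (fun h1 => hx h1.1) x'
  · by_cases hc : X.color x = X.color z
    · have h1 := congrFun (congrFun (hGG (X.color x)) x) z
      rw [Matrix.mul_apply, Matrix.mul_apply] at h1
      simp only [Matrix.conjTranspose_apply, Matrix.of_apply, if_true, if_pos hc.symm] at h1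
      rw [entry_comp, entry_comp]
      simp only [entry_adjoint, entry_homMk, ← hc, hG]
      exact h1.symm
    · rw [entry_eq_zero _ fun h1 => hc h1.2.2]
      exact (entry_eq_zero _ fun h1 => hc h1.2.2).symm

theorem adjoint_tensorMap {X Y X' Y' : S.Obj} (f : X ⟶ Y) (g : X' ⟶ Y') :
    adjoint (tensorMap f g) = tensorMap (adjoint f) (adjoint g) := by
  refine hom_ext fun q p => ?_
  obtain ⟨x, x', k, rfl⟩ := exists_pair p
  obtain ⟨y, y', l, rfl⟩ := exists_pair q
  rw [entry_adjoint, entry_tensorMap, entry_tensorMap, entry_adjoint, entry_adjoint]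
  by_cases hf : entry f x y = 0
  · simp [hf]
  by_cases hg : entry g x' y' = 0
  · simp [hg]
  rw [color_eq hf, color_eq hg]
  grind

/-- The associators are unitary because the inverse symbols are the conjugate ones. -/
theorem adjoint_assocHom (hS : S.IsUnitary) (X Y Z : S.Obj) :
    adjoint (assocHom X Y Z) = assocInv X Y Z := by
  classical
  refine hom_ext fun q p => ?_
  obtain ⟨p, z, k, rfl⟩ := exists_pair p
  obtain ⟨x, y, m, rfl⟩ := exists_pair p
  obtain ⟨x', q, k', rfl⟩ := exists_pair q
  obtain ⟨y', z', n, rfl⟩ := exists_pair q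
  rw [entry_adjoint, entry_assocHom, entry_assocInv, ← hS, apply_ite (starRingEnd ℂ),
    Complex.conj_conj, map_zero]
  grind

theorem conj_entry_id {X : S.Obj} (x y : X.Idx) :
    (starRingEnd ℂ) (entry (𝟙 X) x y) = entry (𝟙 X) y x := by
  classical
  rw [entry_id_comm, entry_id, apply_ite (starRingEnd ℂ), map_one, map_zero]

theorem adjoint_leftHom (X : S.Obj) : adjoint (leftHom X) = leftInv X := by
  refine hom_ext fun x p => ?_
  obtain ⟨u, x', k, rfl⟩ := exists_pair p
  rw [entry_adjoint, entry_leftHom, entry_leftInv, apply_ite (starRingEnd ℂ), conj_entry_id,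
    map_zero]
  by_cases h : entry (𝟙 X) x x' = 0
  · simp [h]
  · rw [color_eq h]

theorem adjoint_rightHom (X : S.Obj) : adjoint (rightHom X) = rightInv X := by
  refine hom_ext fun x p => ?_
  obtain ⟨x', u, k, rfl⟩ := exists_pair p
  rw [entry_adjoint, entry_rightHom, entry_rightInv, apply_ite (starRingEnd ℂ), conj_entry_id,
    map_zero]
  by_cases h : entry (𝟙 X) x x' = 0
  · simp [h]
  · rw [color_eq h]

/-- If the recoupling matrices are unitary, the conjugate transpose is a unitary structure. -/
def unitaryStructure (hS : S.IsUnitary) : UnitaryStructure S.Obj where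
  dag f := adjoint f
  dag_dag := adjoint_adjoint
  dag_comp := adjoint_comp
  dag_add := adjoint_add
  dag_smul := adjoint_smul
  definite := eq_zero_of_comp_adjoint
  positive := exists_comp_adjoint_eq
  dag_tensor := adjoint_tensorMap
  dag_associator := adjoint_assocHom hS
  dag_leftUnitor := adjoint_leftHom
  dag_rightUnitor := adjoint_rightHom

end Obj

end SphericalSymbols

end FusionRing

theorem theorem3p1 {I : Type u} [Fintype I] [DecidableEq I]
    (R : FusionRing I) (hR : R.MultiplicityOne)
    (d : I → ℝ) (F : I → I → I → I → I → I → ℂ) (p : I → ℂ)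
    (hF : R.IsPentagonSolution F)
    (hp : R.IsPivotalIndicator F p)
    (ha : ∀ i, d i = R.FPdim i)
    (hb : ∀ i, p i = 1)
    (hc : R.IsNormalized d (FusionRing.tetra d F))
    (hd : R.IsA4Symmetric (FusionRing.tetra d F)) :
    ∃ (C : Type u) (_ : Category.{u} C) (_ : Abelian C) (_ : Linear ℂ C)
      (_ : MonoidalCategory C) (_ : RigidCategory C) (_ : FusionCategory C)
      (P : PivotalStructure C) (X : I → C),
      R.IsCategorification X ∧
      R.RealizesFSymbols X F ∧
      P.IsSpherical ∧
      (∀ i, P.dim (X i) = (d i : ℂ) • 𝟙 (𝟙_ C)) ∧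
      R.IsPseudoUnitary X P ∧
      (R.IsReflectionSymmetric (FusionRing.tetra d F) → IsUnitaryCategory C) := by
  have hpos : ∀ i, 0 < d i := fun i => ha i ▸ R.FPdim_pos i
  have hdual : ∀ i, d (R.dual i) = d i := fun i => by rw [ha, ha, R.FPdim_dual]
  have hone : d R.one = 1 := by rw [ha, R.FPdim_one]
  have hZ : ∀ i₁ i₂ i₃ i₄ i₅ i₆, ¬ R.Admissible i₁ i₂ i₃ i₄ i₅ i₆ →
      FusionRing.tetra d F i₁ i₂ i₃ i₄ i₅ i₆ = 0 := fun _ _ _ _ _ _ h => by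
    rw [FusionRing.tetra, hF.eq_zero _ _ _ _ _ _ h, mul_zero]
  have hP := FusionRing.tetraPentagon_tetra hpos hF
  let S := FusionRing.sphericalSymbols hd hc hpos hdual hone hP hZ
  refine ⟨S.Obj, inferInstance, inferInstance, inferInstance, inferInstance, inferInstance,
    inferInstance, FusionRing.SphericalSymbols.Obj.pivotal S,
    FusionRing.SphericalSymbols.Obj.simple S,
    FusionRing.SphericalSymbols.Obj.isCategorification hR S,
    FusionRing.SphericalSymbols.Obj.realizesFSymbols S F fun i₁ i₂ i₃ i₄ i₅ i₆ => ?_,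
    FusionRing.SphericalSymbols.Obj.pivotal_isSpherical S,
    FusionRing.SphericalSymbols.Obj.dim_simple,
    FusionRing.SphericalSymbols.Obj.isPseudoUnitary S ha,
    fun h => ⟨FusionRing.SphericalSymbols.Obj.unitaryStructure
      (FusionRing.sphericalSymbols_isUnitary hd hc hpos hdual hone hP hZ h)⟩⟩
  have h3 := S.sqrtDim_ne_zero i₃
  have h6 := S.sqrtDim_ne_zero i₆
  have e6 : ((d i₆ : ℝ) : ℂ) = S.sqrtDim i₆ * S.sqrtDim i₆ := (S.sqrtDim_mul_self i₆).symm
  have e36 : ((√(d i₃ * d i₆) : ℝ) : ℂ) = S.sqrtDim i₃ * S.sqrtDim i₆ := by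
    rw [Real.sqrt_mul (hpos i₃).le, Complex.ofReal_mul]
    rfl
  change _ = FusionRing.gaugeU d (FusionRing.tetra d F) i₁ i₂ i₃ i₄ i₅ i₆ * _
  rw [FusionRing.gaugeU, FusionRing.tetra, e6, e36]
  field_simp
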